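/- Let $\omega^+=\omega\cup\{\omega\}$ be the ordinal $\omega+1$ with its usual order. A \emph{time warp} is a map $f\colon\omega^+\to\omega^+$ that preserves arbitrary suprema (equivalently, $f$ is monotone, $f(0)=0$ and $f(\omega)=\bigvee\{f(n)\mid n\in\omega\}$). Let $W$ be the set of all time warps, ordered pointwise. Then $W$ is a lattice with meet $\wedge$, join $\vee$, least element $\bot$ (the constant map $0$) and greatest element $\top$ (which maps $0$ to $0$ and every $p\neq 0$ to $\omega$). Let $\circ$ be composition, $\mathrm{id}$ the identity map, and let $\backslash,/$ be the residuals of composition, i.e. the binary operations on $W$ determined by \[ f\le h/g \iff f\circ g\le h \iff g\le f\backslash h \qquad (f,g,h\in W). \] The \emph{time warp algebra} is $\mathbf W=\langle W,\wedge,\vee,\circ,\backslash,/,\mathrm{id},\bot,\top\rangle$. Terms are built from variables $x_0,x_1,x_2,\dots$ with the binary operation symbols $\wedge,\vee,\circ,\backslash,/$ and the constant symbols $\mathrm{id},\bot,\top$; an equation is an ordered pair of terms $s\approx t$, and it is valid in $\mathbf W$ if $s$ and $t$ have the same value under every assignment of time warps to the variables. \textbf{Theorem.} The equational theory of the time warp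 algebra is decidable: there is an algorithm that, given terms $s$ and $t$, decides whether the equation $s\approx t$ is valid in $\mathbf W$. -/

import Mathlib

/-- Time warps: maps on `ω + 1` (here `ℕ∞`) that preserve arbitrary suprema.
The order that Mathlib puts on `sSupHom` is the pointwise one, and its `⊥` is the constant
map `0`. -/
abbrev TimeWarp : Type := sSupHom ℕ∞ ℕ∞

namespace TimeWarp

theorem mono (f : TimeWarp) : Monotone f := OrderHomClass.mono f

/-- The pointwise supremum of a set of time warps. -/
noncomputable instance : SupSet TimeWarp where
  sSup F :=
    { toFun := fun p => ⨆ f : F, f.1 p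
      map_sSup' := fun s => by
        simp only [map_sSup, sSup_image]
        rw [iSup_comm]
        exact iSup_congr fun a => iSup_comm }

theorem sSup_apply (F : Set TimeWarp) (p : ℕ∞) : (sSup F : TimeWarp) p = ⨆ f : F, f.1 p := rfl

/-- Pointwise binary joins and meets; they are the joins and meets of the pointwise order. -/
noncomputable instance : Lattice TimeWarp where
  sup f g :=
    { toFun := fun p => f p ⊔ g p
      map_sSup' := fun s => by
        simp only [map_sSup, sSup_image, iSup_sup_eq] }
  inf f g :=
    { toFun := fun p => f p ⊓ g p
      map_sSup' := fun s => by
        apply le_antisymm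
        · simp only [map_sSup, sSup_inf_sSup]
          refine iSup₂_le ?_
          rintro ⟨x, y⟩ ⟨⟨a, ha, rfl⟩, ⟨b, hb, rfl⟩⟩
          rcases le_total a b with h | h
          · exact le_trans (inf_le_inf_right _ (mono f h)) (le_sSup ⟨b, hb, rfl⟩)
          · exact le_trans (inf_le_inf_left _ (mono g h)) (le_sSup ⟨a, ha, rfl⟩)
        · refine sSup_le ?_
          rintro _ ⟨a, ha, rfl⟩
          exact inf_le_inf (mono f (le_sSup ha)) (mono g (le_sSup ha)) }
  le_sup_left f g := fun p => le_sup_left (a := f p) (b := g p)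
  le_sup_right f g := fun p => le_sup_right (a := f p) (b := g p)
  sup_le f g h hf hg := fun p => sup_le (hf p) (hg p)
  inf_le_left f g := fun p => inf_le_left (a := f p) (b := g p)
  inf_le_right f g := fun p => inf_le_right (a := f p) (b := g p)
  le_inf f g h hf hg := fun p => le_inf (hf p) (hg p)

/-- The greatest time warp maps `0` to `0` and every other point to `ω`. -/
noncomputable instance : OrderTop TimeWarp where
  top :=
    { toFun := fun p => if p = 0 then 0 else ⊤
      map_sSup' := fun s => by
        apply le_antisymm
        · by_cases h : sSup s = 0
          · simp [h]
          · have h' : ∃ a ∈ s, a ≠ 0 := by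
              by_contra! hc
              exact h (nonpos_iff_eq_zero.mp (sSup_le fun a ha => (hc a ha).le))
            obtain ⟨a, ha, ha0⟩ := h'
            exact le_trans le_top (le_sSup ⟨a, ha, by simp [ha0]⟩)
        · refine sSup_le ?_
          rintro _ ⟨a, ha, rfl⟩
          by_cases h : a = 0
          · simp [h]
          · have : sSup s ≠ 0 := fun h0 => h (nonpos_iff_eq_zero.mp (h0 ▸ le_sSup ha))
            simp [h, this] }
  le_top f := fun p => by
    change f p ≤ if p = 0 then 0 else ⊤
    split_ifs with h
    · subst h
      exact (map_bot f).le
    · exact le_top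

/-- The residual `f \ h`: the largest `g` with `f ∘ g ≤ h`. -/
noncomputable def ld (f h : TimeWarp) : TimeWarp := sSup {g | f.comp g ≤ h}

/-- The residual `h / g`: the largest `f` with `f ∘ g ≤ h`. -/
noncomputable def rd (h g : TimeWarp) : TimeWarp := sSup {f | f.comp g ≤ h}

theorem le_ld_iff (f g h : TimeWarp) : g ≤ ld f h ↔ f.comp g ≤ h := by
  constructor
  · intro H p
    refine le_trans (mono f (H p)) ?_
    rw [ld, sSup_apply, map_iSup]
    exact iSup_le fun k => k.2 p
  · intro H p
    exact le_iSup (fun k : {g : TimeWarp | f.comp g ≤ h} => k.1 p) ⟨g, H⟩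

theorem le_rd_iff (f g h : TimeWarp) : f ≤ rd h g ↔ f.comp g ≤ h := by
  constructor
  · intro H p
    refine le_trans (H (g p)) ?_
    rw [rd, sSup_apply]
    exact iSup_le fun k => k.2 p
  · intro H p
    exact le_iSup (fun k : {f : TimeWarp | f.comp g ≤ h} => k.1 p) ⟨f, H⟩

end TimeWarp

/-- Time warp terms over the variables `x₀, x₁, x₂, …`. -/
inductive WarpTerm : Type
  | var (n : ℕ)
  | id
  | bot
  | top
  | meet (s t : WarpTerm)
  | join (s t : WarpTerm)
  | comp (s t : WarpTerm)
  | ld (s t : WarpTerm)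
  | rd (s t : WarpTerm)

namespace WarpTerm

/-- The value of a term in the time warp algebra under a valuation of the variables;
`ld s t` stands for `s \ t` and `rd s t` for `s / t`. -/
noncomputable def eval (θ : ℕ → TimeWarp) : WarpTerm → TimeWarp
  | var n => θ n
  | id => sSupHom.id ℕ∞
  | bot => ⊥
  | top => ⊤
  | meet s t => eval θ s ⊓ eval θ t
  | join s t => eval θ s ⊔ eval θ t
  | comp s t => (eval θ s).comp (eval θ t)
  | ld s t => TimeWarp.ld (eval θ s) (eval θ t)
  | rd s t => TimeWarp.rd (eval θ s) (eval θ t)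

/-- A Gödel numbering of the terms (`Nat.pair` is a primitive recursive bijection
`ℕ × ℕ → ℕ`). -/
def code : WarpTerm → ℕ
  | id => 0
  | bot => 1
  | top => 2
  | var n => 6 * n + 3
  | meet s t => 6 * Nat.pair (code s) (code t) + 4
  | join s t => 6 * Nat.pair (code s) (code t) + 5
  | comp s t => 6 * Nat.pair (code s) (code t) + 6
  | ld s t => 6 * Nat.pair (code s) (code t) + 7
  | rd s t => 6 * Nat.pair (code s) (code t) + 8

/-- The term with a given Gödel number. -/
def ofCode : ℕ → WarpTerm
  | 0 => id
  | 1 => bot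
  | 2 => top
  | n + 3 =>
    have hm : n / 6 < n + 3 := by omega
    have _h1 : (n / 6).unpair.1 < n + 3 := lt_of_le_of_lt (n / 6).unpair_left_le hm
    have _h2 : (n / 6).unpair.2 < n + 3 := lt_of_le_of_lt (n / 6).unpair_right_le hm
    match n % 6 with
    | 0 => var (n / 6)
    | 1 => meet (ofCode (n / 6).unpair.1) (ofCode (n / 6).unpair.2)
    | 2 => join (ofCode (n / 6).unpair.1) (ofCode (n / 6).unpair.2)
    | 3 => comp (ofCode (n / 6).unpair.1) (ofCode (n / 6).unpair.2)
    | 4 => ld (ofCode (n / 6).unpair.1) (ofCode (n / 6).unpair.2)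
    | _ => rd (ofCode (n / 6).unpair.1) (ofCode (n / 6).unpair.2)

theorem ofCode_code (t : WarpTerm) : ofCode (code t) = t := by
  have e (a r : ℕ) (hr : r < 6) : (6 * a + r) / 6 = a ∧ (6 * a + r) % 6 = r := by omega
  induction t with
  | var n => simp [code, ofCode]
  | id => simp [code, ofCode]
  | bot => simp [code, ofCode]
  | top => simp [code, ofCode]
  | meet s t hs ht =>
    have := e (Nat.pair (code s) (code t)) 1 (by omega)
    rw [code, ofCode]; simp only [this, Nat.unpair_pair, hs, ht]
  | join s t hs ht =>
    have := e (Nat.pair (code s) (code t)) 2 (by omega)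
    rw [code, ofCode]; simp only [this, Nat.unpair_pair, hs, ht]
  | comp s t hs ht =>
    have := e (Nat.pair (code s) (code t)) 3 (by omega)
    rw [code, ofCode]; simp only [this, Nat.unpair_pair, hs, ht]
  | ld s t hs ht =>
    have := e (Nat.pair (code s) (code t)) 4 (by omega)
    rw [code, ofCode]; simp only [this, Nat.unpair_pair, hs, ht]
  | rd s t hs ht =>
    have := e (Nat.pair (code s) (code t)) 5 (by omega)
    rw [code, ofCode]; simp only [this, Nat.unpair_pair, hs, ht]

theorem code_ofCode (n : ℕ) : code (ofCode n) = n := by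
  induction n using Nat.strong_induction_on with
  | _ n ih =>
    match n with
    | 0 => simp [code, ofCode]
    | 1 => simp [code, ofCode]
    | 2 => simp [code, ofCode]
    | n + 3 =>
      have hm : n / 6 < n + 3 := by omega
      have h1 := ih _ (lt_of_le_of_lt (n / 6).unpair_left_le hm)
      have h2 := ih _ (lt_of_le_of_lt (n / 6).unpair_right_le hm)
      have h6 : n % 6 = 0 ∨ n % 6 = 1 ∨ n % 6 = 2 ∨ n % 6 = 3 ∨ n % 6 = 4 ∨ n % 6 = 5 := by omega
      rw [ofCode]
      rcases h6 with h | h | h | h | h | h <;>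
        simp only [h, code, h1, h2, Nat.pair_unpair] <;> omega

/-- Terms are encoded by their Gödel numbers; this is the encoding that Mathlib's notion of
computability uses for `WarpTerm`. -/
instance : Denumerable WarpTerm :=
  Denumerable.mk' ⟨code, ofCode, ofCode_code, code_ofCode⟩

end WarpTerm

/-- The equation `s ≈ t` (as the ordered pair `(s, t)`) is valid in the time warp algebra. -/
def TimeWarp.Models (e : WarpTerm × WarpTerm) : Prop :=
  ∀ θ : ℕ → TimeWarp, e.1.eval θ = e.2.eval θ

/-- The equational theory of the time warp algebra: the set of all valid equations. -/
def TimeWarp.equationalTheory : Set (WarpTerm × WarpTerm) :=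
  {e | TimeWarp.Models e}

/-! An equation fails exactly when a finite table of bounded size refutes it, so validity can be
decided by a bounded search.

The residuals are computed locally. For `n ≠ 0`, the value of `f \ h` at `n` is the `r` with `f r ≤
h n` and, if `r` is finite, `h n < f (r + 1)`. The value of `h / g` at `n` is `h (k + 1)` when `g k
< n ≤ g (k + 1)`, and `ω` when `g ω < n` (`ld_apply_eq`, `rd_apply_eq`). At `ω` one more bit per
argument is needed: whether it attains `ω` at a finite point. For compound terms this bit is
determined by the bits of the arguments and by values at `ω` (`reachesTop_comp`, `reachesTop_ld`,
`reachesTop_rd`).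

A certificate is a partial table with one row per term code up to `N`, subject to these local
conditions. Soundness (`IsCertificate.exists_represents`): each variable row extends to a time warp
(`exists_represents_of_isVar`), and by induction on terms every row then agrees with the value of
its term.

Completeness (`exists_isCertificate`): given a refuting valuation and a point, close `0`, `ω` and
that point under the finitely many points needed to evaluate all terms, a bounded number of times.
Replacing the finite points by their ranks preserves order, `0`, `ω` and successors, which is all
that the conditions mention. The number of points is bounded in `N` alone. Tables are coded by
numbers, and every condition is a bounded quantification, so validity is even primitive recursive.
-/

namespace TimeWarp

/-! ### Continuity at `ω` and the local description of the residuals. -/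

theorem map_zero (f : TimeWarp) : f 0 = 0 := map_bot f

theorem apply_top (f : TimeWarp) : f ⊤ = ⨆ n : ℕ, f n := by
  rw [← map_iSup, ENat.iSup_natCast]

theorem exists_lt_apply {f : TimeWarp} {x : ℕ∞} (h : x < f ⊤) : ∃ n : ℕ, x < f n := by
  rwa [apply_top, lt_iSup_iff] at h

theorem exists_le_apply {f : TimeWarp} {x : ℕ∞} (hx : x ≠ ⊤) (h : x ≤ f ⊤) :
    ∃ n : ℕ, x ≤ f n := by
  rcases eq_or_ne x 0 with rfl | h0
  · exact ⟨0, zero_le⟩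
  · lift x to ℕ using hx
    obtain ⟨k, rfl⟩ := Nat.exists_eq_succ_of_ne_zero (by simpa using h0)
    obtain ⟨n, hn⟩ := exists_lt_apply (f := f) (x := k)
      (lt_of_lt_of_le (by exact_mod_cast k.lt_succ_self) h)
    exact ⟨n, by simpa using Order.add_one_le_of_lt hn⟩

theorem exists_apply_eq {f : TimeWarp} (h : f ⊤ ≠ ⊤) : ∃ n : ℕ, f n = f ⊤ := by
  obtain ⟨n, hn⟩ := exists_le_apply h le_rfl
  exact ⟨n, le_antisymm (f.mono le_top) hn⟩

theorem apply_le_of_forall_nat {f : TimeWarp} {x : ℕ∞} (h : ∀ n : ℕ, f n ≤ x) : f ⊤ ≤ x := by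
  rw [apply_top]
  exact iSup_le h

/-- Since `n + 1 ≤ x` means `n < x`, positive finite points are compact. This is what makes step
functions and `ofSeq` preserve suprema. -/
theorem add_one_le_sSup_iff (n : ℕ) (s : Set ℕ∞) :
    ((n + 1 : ℕ) : ℕ∞) ≤ sSup s ↔ ∃ x ∈ s, ((n + 1 : ℕ) : ℕ∞) ≤ x := by
  simp only [Nat.cast_add, Nat.cast_one, ENat.add_one_le_iff (ENat.natCast_ne_top n), lt_sSup_iff]

/-- The warp with value `r` from `n + 1` on, and `0` below. -/
noncomputable def step (n : ℕ) (r : ℕ∞) : TimeWarp where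
  toFun p := if ((n + 1 : ℕ) : ℕ∞) ≤ p then r else 0
  map_sSup' s := by
    apply le_antisymm
    · split_ifs with h
      · obtain ⟨x, hx, hn⟩ := (add_one_le_sSup_iff n s).1 h
        exact le_sSup ⟨x, hx, if_pos hn⟩
      · exact zero_le
    · refine sSup_le ?_
      rintro _ ⟨x, hx, rfl⟩
      dsimp only
      split_ifs with h h' h'
      · exact le_rfl
      · exact absurd ((add_one_le_sSup_iff n s).2 ⟨x, hx, h⟩) h'
      · exact zero_le
      · exact le_rfl

theorem step_apply (n : ℕ) (r p : ℕ∞) :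
    step n r p = if ((n + 1 : ℕ) : ℕ∞) ≤ p then r else 0 := rfl

/-- A step function is the least warp with a given lower bound at `n + 1`. Testing the adjunctions
against step functions therefore yields the values of the residuals at finite nonzero points. -/
theorem step_le_iff (n : ℕ) (r : ℕ∞) (g : TimeWarp) :
    step n r ≤ g ↔ r ≤ g ((n + 1 : ℕ) : ℕ∞) := by
  constructor
  · intro h
    simpa [step_apply] using h ((n + 1 : ℕ) : ℕ∞)
  · intro h p
    change step n r p ≤ g p
    rw [step_apply]
    split_ifs with hp
    · exact h.trans (g.mono hp)
    · exact zero_le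

theorem le_ld_apply_iff (f h : TimeWarp) (n : ℕ) (hn : n ≠ 0) (r : ℕ∞) :
    r ≤ ld f h n ↔ f r ≤ h n := by
  obtain ⟨n, rfl⟩ := Nat.exists_eq_succ_of_ne_zero hn
  rw [← step_le_iff, le_ld_iff]
  constructor
  · intro H
    simpa [step_apply] using H ((n + 1 : ℕ) : ℕ∞)
  · intro H p
    change f (step n r p) ≤ h p
    rw [step_apply]
    split_ifs with hp
    · exact H.trans (h.mono hp)
    · rw [map_zero]
      exact zero_le

theorem le_rd_apply_iff (h g : TimeWarp) (n : ℕ) (hn : n ≠ 0) (r : ℕ∞) :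
    r ≤ rd h g n ↔ ∀ p, (n : ℕ∞) ≤ g p → r ≤ h p := by
  obtain ⟨n, rfl⟩ := Nat.exists_eq_succ_of_ne_zero hn
  rw [← step_le_iff, le_rd_iff]
  constructor
  · intro H p hp
    have := H p
    change step n r (g p) ≤ h p at this
    rwa [step_apply, if_pos hp] at this
  · intro H p
    change step n r (g p) ≤ h p
    rw [step_apply]
    split_ifs with hp
    · exact H p hp
    · exact zero_le

/-- The warp that takes the supremum of a sequence up to the given point. -/
noncomputable def ofSeq (f : ℕ → ℕ∞) (h0 : f 0 = 0) : TimeWarp where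
  toFun p := ⨆ n : ℕ, ⨆ _ : (n : ℕ∞) ≤ p, f n
  map_sSup' s := by
    apply le_antisymm
    · refine iSup₂_le fun n hn => ?_
      rcases n with _ | n
      · rw [h0]
        exact zero_le
      · obtain ⟨x, hx, hn⟩ := (add_one_le_sSup_iff n s).1 hn
        exact le_trans (le_iSup₂ (f := fun (n : ℕ) (_ : (n : ℕ∞) ≤ x) => f n) (n + 1) hn)
          (le_sSup ⟨x, hx, rfl⟩)
    · refine sSup_le ?_
      rintro _ ⟨x, hx, rfl⟩
      exact iSup₂_le fun n hn =>
        le_iSup₂ (f := fun (n : ℕ) (_ : (n : ℕ∞) ≤ sSup s) => f n) n (hn.trans (le_sSup hx))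

theorem ofSeq_apply_nat (f : ℕ → ℕ∞) (h0 : f 0 = 0) (hf : Monotone f) (n : ℕ) :
    ofSeq f h0 n = f n := by
  change (⨆ m : ℕ, ⨆ _ : (m : ℕ∞) ≤ n, f m) = f n
  exact le_antisymm (iSup₂_le fun m hm => hf (by exact_mod_cast hm))
    (le_iSup₂ (f := fun (m : ℕ) (_ : (m : ℕ∞) ≤ n) => f m) n le_rfl)

/-- The point `r` is the largest with image at most `h n`: for this it suffices to look at `r` and
its successor, which is what a finite table can check. -/
theorem ld_apply_eq (f h : TimeWarp) {n : ℕ} (hn : n ≠ 0) {r : ℕ∞} (hr : f r ≤ h n)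
    (hr' : r ≠ ⊤ → h n < f (r + 1)) : ld f h n = r := by
  refine le_antisymm ?_ ((le_ld_apply_iff f h n hn r).2 hr)
  by_contra hlt
  have hlt := not_le.1 hlt
  have := (le_ld_apply_iff f h n hn _).1 (Order.add_one_le_of_lt hlt)
  exact absurd this (not_le.2 (hr' hlt.ne_top))

theorem apply_ld_le (f h : TimeWarp) {n : ℕ} (hn : n ≠ 0) : f (ld f h n) ≤ h n :=
  (le_ld_apply_iff f h n hn _).1 le_rfl

theorem lt_apply_ld_add_one (f h : TimeWarp) {n : ℕ} (hn : n ≠ 0) (ht : ld f h n ≠ ⊤) :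
    h n < f (ld f h n + 1) := by
  by_contra hle
  have := (le_ld_apply_iff f h n hn _).2 (not_lt.1 hle)
  exact absurd this (not_le.2 ((ENat.lt_add_one_iff ht).2 le_rfl))

/-- By the adjunction the value is the infimum of `h` over the points that `g` sends to at least
`n`, and `k + 1` is the least of these. -/
theorem rd_apply_eq (h g : TimeWarp) {n : ℕ} (hn : n ≠ 0) {k : ℕ} (hk : g k < n)
    (hk' : (n : ℕ∞) ≤ g (k + 1)) : rd h g n = h (k + 1) := by
  refine le_antisymm ((le_rd_apply_iff h g n hn _).1 le_rfl _ hk') ?_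
  refine (le_rd_apply_iff h g n hn _).2 fun p hp => h.mono ?_
  refine Order.add_one_le_of_lt (not_le.1 fun hle => ?_)
  exact absurd (hp.trans (g.mono hle)) (not_le.2 hk)

theorem rd_apply_eq_top (h g : TimeWarp) {n : ℕ} (hn : g ⊤ < n) : rd h g n = ⊤ := by
  have h0 : n ≠ 0 := by
    rintro rfl
    simp at hn
  refine top_le_iff.1 ((le_rd_apply_iff h g n h0 _).2 fun p hp => ?_)
  exact absurd (hp.trans (g.mono le_top)) (not_le.2 hn)

/-! ### Values of the residuals at `ω`. -/

/-- A warp that takes the value `⊤` at a finite point. -/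
def ReachesTop (f : TimeWarp) : Prop := ∃ n : ℕ, f n = ⊤

theorem ReachesTop.apply_top {f : TimeWarp} (h : f.ReachesTop) : f ⊤ = ⊤ := by
  obtain ⟨n, hn⟩ := h
  exact top_le_iff.1 (hn.symm.le.trans (f.mono le_top))

theorem exists_apply_lt_le_apply_add_one {g : TimeWarp} {x : ℕ∞} (h0 : x ≠ 0) (n : ℕ)
    (hn : x ≤ g n) :
    ∃ k : ℕ, g k < x ∧ x ≤ g (k + 1) := by
  classical
  have hex : ∃ n : ℕ, x ≤ g n := ⟨n, hn⟩
  have hz : Nat.find hex ≠ 0 := fun hz => by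
    have := Nat.find_spec hex
    rw [hz, Nat.cast_zero, map_zero] at this
    exact h0 (le_antisymm this zero_le)
  obtain ⟨k, hk⟩ := Nat.exists_eq_succ_of_ne_zero hz
  refine ⟨k, not_le.1 (Nat.find_min hex (by omega)), ?_⟩
  have := Nat.find_spec hex
  rw [hk] at this
  exact_mod_cast this

theorem exists_nat_apply_eq_top {h : TimeWarp} (hh : h ⊤ = ⊤ → h.ReachesTop) :
    ∃ n : ℕ, n ≠ 0 ∧ h n = h ⊤ := by
  obtain ⟨n, hn⟩ : ∃ n : ℕ, h n = h ⊤ := by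
    by_cases ht : h ⊤ = ⊤
    · rw [ht]
      exact hh ht
    · exact exists_apply_eq ht
  refine ⟨n + 1, by omega, le_antisymm (h.mono le_top) ?_⟩
  rw [← hn]
  exact h.mono (by exact_mod_cast n.le_succ)

theorem ld_apply_top_eq_nat (f : TimeWarp) {h : TimeWarp} {n : ℕ} (hn : n ≠ 0)
    (hh : h n = h ⊤) : ld f h ⊤ = ld f h n := by
  refine le_antisymm (apply_le_of_forall_nat fun m => ?_) (mono _ le_top)
  rcases eq_or_ne m 0 with rfl | hm
  · rw [Nat.cast_zero, map_zero]
    exact zero_le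
  · rw [le_ld_apply_iff f h n hn, hh]
    exact (apply_ld_le f h hm).trans (h.mono le_top)

theorem le_ld_apply_top (f h : TimeWarp) {r : ℕ∞} (hh : h ⊤ = ⊤) (hr : f r ≠ ⊤) :
    r ≤ ld f h ⊤ := by
  obtain ⟨n, hn⟩ := exists_lt_apply (f := h) (x := f r) (by rw [hh]; exact hr.lt_top)
  have h0 : n ≠ 0 := by
    rintro rfl
    simp [map_zero] at hn
  exact ((le_ld_apply_iff f h n h0 r).2 hn.le).trans (mono _ le_top)

theorem ld_apply_top_eq_top (f h : TimeWarp) (hh : h ⊤ = ⊤) (hf : ¬ f.ReachesTop) :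
    ld f h ⊤ = ⊤ :=
  ENat.eq_top_iff_forall_ge.2 fun m => le_ld_apply_top f h hh fun hm => hf ⟨m, hm⟩

/-- Here `h` grows to `ω` through finite values. Every finite value of `f` is eventually below `h
n`, but `f (k + 1) = ω` never is, so the residual stops at `k`. -/
theorem ld_apply_top_eq (f h : TimeWarp) (hh : h ⊤ = ⊤) (hh' : ¬ h.ReachesTop) {k : ℕ∞}
    (hk : f k ≠ ⊤) (hk' : f (k + 1) = ⊤) : ld f h ⊤ = k := by
  refine le_antisymm (apply_le_of_forall_nat fun n => ?_) (le_ld_apply_top f h hh hk)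
  rcases eq_or_ne n 0 with rfl | hn
  · rw [Nat.cast_zero, map_zero]
    exact zero_le
  · by_contra hlt
    have := (le_ld_apply_iff f h n hn _).1 (Order.add_one_le_of_lt (not_le.1 hlt))
    rw [hk', top_le_iff] at this
    exact hh' ⟨n, this⟩

theorem rd_apply_top_eq_top (h g : TimeWarp) (hg : g ⊤ ≠ ⊤) : rd h g ⊤ = ⊤ := by
  obtain ⟨m, hm⟩ := ENat.ne_top_iff_exists.1 hg
  have : rd h g ((m + 1 : ℕ) : ℕ∞) = ⊤ :=
    rd_apply_eq_top h g (by rw [← hm]; exact_mod_cast m.lt_succ_self)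
  exact top_le_iff.1 (this.symm.le.trans (mono _ le_top))

theorem rd_apply_eq_of_apply_add_one_eq_top (h g : TimeWarp) {k n : ℕ} (hk : g k < n)
    (hk' : g (k + 1) = ⊤) : rd h g n = h (k + 1) := by
  refine rd_apply_eq h g ?_ hk (hk' ▸ le_top)
  rintro rfl
  simp at hk

/-- For every finite `n` above `g k`, the least point that `g` sends to at least `n` is the same `k
+ 1`, so the residual is eventually constant. -/
theorem rd_apply_top_eq (h g : TimeWarp) {k : ℕ} (hk : g k ≠ ⊤) (hk' : g (k + 1) = ⊤) :
    rd h g ⊤ = h (k + 1) := by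
  obtain ⟨m, hm⟩ := ENat.ne_top_iff_exists.1 hk
  have key : ∀ n : ℕ, m < n → rd h g n = h (k + 1) := fun n hn =>
    rd_apply_eq_of_apply_add_one_eq_top h g (by rw [← hm]; exact_mod_cast hn) hk'
  refine le_antisymm (apply_le_of_forall_nat fun n => ?_) ?_
  · rw [← key (n + m + 1) (by omega)]
    exact mono _ (by exact_mod_cast (by omega : n ≤ n + m + 1))
  · rw [← key (m + 1) (by omega)]
    exact mono _ le_top

/-- Since `g` tends to `ω` through finite values, the least point with image at least `n` is finite
but moves to `ω` with `n`; continuity of `h` gives the limit. -/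
theorem rd_apply_top (h g : TimeWarp) (hg : g ⊤ = ⊤) (hg' : ¬ g.ReachesTop) :
    rd h g ⊤ = h ⊤ := by
  refine le_antisymm (apply_le_of_forall_nat fun n => ?_) (apply_le_of_forall_nat fun n => ?_)
  · rcases eq_or_ne n 0 with rfl | hn
    · rw [Nat.cast_zero, map_zero]
      exact zero_le
    · exact (le_rd_apply_iff h g n hn _).1 le_rfl ⊤ (le_top.trans hg.symm.le)
  · obtain ⟨m, hm⟩ := ENat.ne_top_iff_exists.1 (fun ht => hg' ⟨n, ht⟩ : g n ≠ ⊤)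
    refine le_trans ?_ (mono _ (le_top : ((m + 1 : ℕ) : ℕ∞) ≤ ⊤))
    refine (le_rd_apply_iff h g _ (by omega) _).2 fun p hp => h.mono ?_
    refine (not_le.1 fun hle => ?_).le
    have := hp.trans (g.mono hle)
    rw [← hm] at this
    exact absurd this (by exact_mod_cast (by omega : ¬ m + 1 ≤ m))

/-! ### How attaining `ω` at a finite point depends on the arguments. -/

theorem inf_apply (f g : TimeWarp) (p : ℕ∞) : (f ⊓ g) p = f p ⊓ g p := rfl

theorem sup_apply (f g : TimeWarp) (p : ℕ∞) : (f ⊔ g) p = f p ⊔ g p := rfl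

theorem top_apply (p : ℕ∞) : (⊤ : TimeWarp) p = if p = 0 then 0 else ⊤ := rfl

theorem ReachesTop.apply_of_le {f : TimeWarp} {m n : ℕ} (h : f m = ⊤) (hmn : m ≤ n) :
    f n = ⊤ :=
  top_le_iff.1 (h.symm.le.trans (f.mono (by exact_mod_cast hmn)))

theorem reachesTop_inf {f g : TimeWarp} :
    (f ⊓ g).ReachesTop ↔ f.ReachesTop ∧ g.ReachesTop := by
  constructor
  · rintro ⟨n, hn⟩
    rw [inf_apply, inf_eq_top_iff] at hn
    exact ⟨⟨n, hn.1⟩, ⟨n, hn.2⟩⟩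
  · rintro ⟨⟨m, hm⟩, ⟨n, hn⟩⟩
    refine ⟨max m n, ?_⟩
    rw [inf_apply, ReachesTop.apply_of_le hm (le_max_left m n),
      ReachesTop.apply_of_le hn (le_max_right m n), inf_idem]

theorem reachesTop_sup {f g : TimeWarp} :
    (f ⊔ g).ReachesTop ↔ f.ReachesTop ∨ g.ReachesTop := by
  constructor
  · rintro ⟨n, hn⟩
    rw [sup_apply] at hn
    rcases max_choice (f n) (g n) with h | h
    · exact Or.inl ⟨n, by rw [← h]; exact hn⟩
    · exact Or.inr ⟨n, by rw [← h]; exact hn⟩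
  · rintro (⟨n, hn⟩ | ⟨n, hn⟩)
    · exact ⟨n, by rw [sup_apply, hn, top_sup_eq]⟩
    · exact ⟨n, by rw [sup_apply, hn, sup_top_eq]⟩

theorem reachesTop_comp {f g : TimeWarp} :
    ReachesTop (f.comp g) ↔ f (g ⊤) = ⊤ ∧ (f.ReachesTop ∨ g.ReachesTop) := by
  constructor
  · intro h
    refine ⟨h.apply_top, ?_⟩
    obtain ⟨n, hn⟩ := h
    rw [sSupHom.comp_apply] at hn
    by_cases hg : g n = ⊤
    · exact Or.inr ⟨n, hg⟩
    · obtain ⟨m, hm⟩ := ENat.ne_top_iff_exists.1 hg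
      exact Or.inl ⟨m, by rw [hm, hn]⟩
  · rintro ⟨ht, ⟨m, hm⟩ | ⟨n, hn⟩⟩
    · by_cases hg : g ⊤ = ⊤
      · obtain ⟨n, hn⟩ := exists_le_apply (f := g) (ENat.natCast_ne_top m) (le_top.trans hg.symm.le)
        exact ⟨n, top_le_iff.1 (hm.symm.le.trans (f.mono hn))⟩
      · obtain ⟨n, hn⟩ := exists_apply_eq hg
        exact ⟨n, by rw [sSupHom.comp_apply, hn, ht]⟩
    · refine ⟨n, top_le_iff.1 (ht.symm.le.trans (f.mono ?_))⟩
      rw [hn]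
      exact le_top

/-- The residual is `ω` at `n ≠ 0` exactly when `f ω ≤ h n`. If `f ω` is finite, continuity of `h`
supplies such an `n`; otherwise `h n` itself has to be `ω`. -/
theorem reachesTop_ld {f h : TimeWarp} :
    (ld f h).ReachesTop ↔ f ⊤ ≤ h ⊤ ∧ (f ⊤ ≠ ⊤ ∨ h.ReachesTop) := by
  constructor
  · rintro ⟨n, hn⟩
    have h0 : n ≠ 0 := by
      rintro rfl
      rw [Nat.cast_zero, map_zero] at hn
      exact absurd hn (by simp)
    have hle := apply_ld_le f h h0
    rw [hn] at hle
    refine ⟨hle.trans (h.mono le_top), ?_⟩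
    by_cases hf : f ⊤ = ⊤
    · exact Or.inr ⟨n, top_le_iff.1 (hf ▸ hle)⟩
    · exact Or.inl hf
  · rintro ⟨hle, hor⟩
    obtain ⟨n, hn⟩ : ∃ n : ℕ, f ⊤ ≤ h n := by
      rcases hor with hf | ⟨n, hn⟩
      · exact exists_le_apply hf hle
      · exact ⟨n, le_top.trans hn.symm.le⟩
    refine ⟨n + 1, top_le_iff.1 ((le_ld_apply_iff f h (n + 1) (by omega) ⊤).2 ?_)⟩
    exact hn.trans (h.mono (by exact_mod_cast n.le_succ))

/-- If `g` tends to `ω` without attaining it, each residual value at a finite point is bounded by a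
value of `h` at a finite point. In the other cases the residual attains its value at `ω` already at
a finite point. -/
theorem reachesTop_rd {h g : TimeWarp} :
    (rd h g).ReachesTop ↔
      rd h g ⊤ = ⊤ ∧ (g ⊤ ≠ ⊤ ∨ g.ReachesTop ∨ h.ReachesTop) := by
  constructor
  · intro hr
    refine ⟨hr.apply_top, ?_⟩
    by_contra! hcon
    obtain ⟨hg, hg', hh⟩ := hcon
    obtain ⟨n, hn⟩ := hr
    obtain ⟨m, hm⟩ := exists_le_apply (f := g) (ENat.natCast_ne_top n) (le_top.trans hg.symm.le)
    have h0 : n ≠ 0 := by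
      rintro rfl
      rw [Nat.cast_zero, map_zero] at hn
      exact absurd hn (by simp)
    exact hh ⟨m, top_le_iff.1 (hn ▸ (le_rd_apply_iff h g n h0 _).1 le_rfl m hm)⟩
  · rintro ⟨ht, hor⟩
    by_cases hg : g ⊤ = ⊤
    swap
    · obtain ⟨m, hm⟩ := ENat.ne_top_iff_exists.1 hg
      exact ⟨m + 1, rd_apply_eq_top h g (by rw [← hm]; exact_mod_cast m.lt_succ_self)⟩
    by_cases hg' : g.ReachesTop
    · obtain ⟨n, hn⟩ := hg'
      obtain ⟨k, hk, hk'⟩ := exists_apply_lt_le_apply_add_one (by simp) n hn.symm.le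
      obtain ⟨m, hm⟩ := ENat.ne_top_iff_exists.1 hk.ne
      refine ⟨m + 1, ?_⟩
      rw [← ht, rd_apply_top_eq h g hk.ne (top_le_iff.1 hk')]
      exact rd_apply_eq_of_apply_add_one_eq_top h g (by rw [← hm]; exact_mod_cast m.lt_succ_self)
        (top_le_iff.1 hk')
    · obtain ⟨n, hn⟩ : h.ReachesTop := by tauto
      obtain ⟨m, hm⟩ := ENat.ne_top_iff_exists.1 (fun ht => hg' ⟨n, ht⟩ : g n ≠ ⊤)
      refine ⟨m + 1, top_le_iff.1 ((le_rd_apply_iff h g (m + 1) (by omega) _).2 fun p hp => ?_)⟩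
      rw [← hn]
      refine h.mono (not_le.1 fun hle => ?_).le
      have := hp.trans (g.mono hle)
      rw [← hm] at this
      exact absurd this (by exact_mod_cast (by omega : ¬ m + 1 ≤ m))

end TimeWarp

/-!
A row `U : ℕ → ℕ` with parameter `T` is a finite partial table of a time warp: the points
`p < T` are finite, `T` stands for `ω`, and a value above `T` means that the row is undefined
at the point. The predicates below say that one row is, as far as it is defined, the result
of an operation applied to other rows.
-/

namespace Row

/-- The row takes the value `ω` at a finite point. -/
def Reaches (T : ℕ) (U : ℕ → ℕ) : Prop := ∃ m < T, U m = T

/-- Quantifiers over points are written with strict bounds, the form in which they are seen to be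
primitive recursive. Undefined entries, those above `T`, are not constrained. -/
def IsId (T : ℕ) (U : ℕ → ℕ) : Prop := ∀ p < T + 1, U p ≤ T → U p = p

def IsBot (T : ℕ) (U : ℕ → ℕ) : Prop := ∀ p < T + 1, U p ≤ T → U p = 0

def IsTop (T : ℕ) (U : ℕ → ℕ) : Prop :=
  (∀ p < T + 1, U p ≤ T → (p = 0 ∧ U p = 0 ∨ p ≠ 0 ∧ U p = T)) ∧ Reaches T U

/-- The last clause is continuity at `ω`: a finite value at `ω` has to be attained earlier. -/
def IsVar (T : ℕ) (U : ℕ → ℕ) : Prop :=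
  (∀ p < T + 1, U p ≤ T →
    (p = 0 → U p = 0) ∧ ∀ q < T + 1, p ≤ q → U q ≤ T → U p ≤ U q) ∧
  (U T = T ∨ ∃ m < T, U m = U T)

/-- In this and the following conditions a defined entry forces the entries it depends on to be
defined. Attaining `ω` is only required to pass from the arguments to the result, because the
converse follows from the values. -/
def IsMeet (T : ℕ) (U A B : ℕ → ℕ) : Prop :=
  (∀ p < T + 1, U p ≤ T → A p ≤ T ∧ B p ≤ T ∧ U p = min (A p) (B p)) ∧
  (Reaches T A → Reaches T B → Reaches T U)

def IsJoin (T : ℕ) (U A B : ℕ → ℕ) : Prop :=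
  (∀ p < T + 1, U p ≤ T → A p ≤ T ∧ B p ≤ T ∧ U p = max (A p) (B p)) ∧
  (Reaches T A ∨ Reaches T B → Reaches T U)

def IsComp (T : ℕ) (U A B : ℕ → ℕ) : Prop :=
  (∀ p < T + 1, U p ≤ T → B p ≤ T ∧ U p = A (B p)) ∧
  (U T = T → Reaches T A ∨ Reaches T B → Reaches T U)

/-- `v` is the largest point whose image under `A` is at most `w`. -/
def IsRes (T : ℕ) (A : ℕ → ℕ) (w v : ℕ) : Prop :=
  w ≤ T ∧ A v ≤ w ∧ (v < T → v + 1 < T ∧ w < A (v + 1) ∧ A (v + 1) ≤ T)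

/-- `v` is the value at `ω` of a left residual by `A` whose numerator takes the value `ω`
at `ω` only. -/
def IsLimRes (T : ℕ) (A : ℕ → ℕ) (v : ℕ) : Prop :=
  (¬ Reaches T A → v = T) ∧ (Reaches T A → v + 1 < T ∧ A v < T ∧ A (v + 1) = T)

/-- The point `ω` is exceptional only if the numerator tends to `ω` without attaining it. Otherwise
the numerator attains its value at `ω` at a finite point, and the rule for finite points applies. -/
def IsLd (T : ℕ) (U A B : ℕ → ℕ) : Prop :=
  (∀ p < T + 1, U p ≤ T →
    (p = 0 → U p = 0) ∧
    (p = T → B T = T → ¬ Reaches T B → IsLimRes T A (U T)) ∧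
    (p ≠ 0 → ¬ (p = T ∧ B T = T ∧ ¬ Reaches T B) → IsRes T A (B p) (U p))) ∧
  (A T ≤ B T → (A T < T ∨ Reaches T B) → Reaches T U)

/-- `v` is the value of `A` at the least point whose image under `B` is at least `p`. -/
def IsPull (T : ℕ) (A B : ℕ → ℕ) (p v : ℕ) : Prop :=
  ∃ k < T, k + 1 < T ∧ B k < p ∧ p ≤ B (k + 1) ∧ B (k + 1) ≤ T ∧ v = A (k + 1)

def IsRd (T : ℕ) (U A B : ℕ → ℕ) : Prop :=
  (∀ p < T + 1, U p ≤ T →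
    (p = 0 → U p = 0) ∧
    (B T < p → U p = T) ∧
    (p ≠ 0 → p ≤ B T →
      ((p = T ∧ ¬ Reaches T B ∧ U T = A T) ∨ IsPull T A B p (U p)))) ∧
  (U T = T → (B T < T ∨ Reaches T B ∨ Reaches T A) → Reaches T U)

/-! ### Soundness: rows satisfying the local conditions describe the results of the operations. -/

/-- The point of `ℕ∞` that an entry at most `T` stands for. -/
noncomputable def point (T p : ℕ) : ℕ∞ := if p < T then p else ⊤

theorem point_of_lt {T p : ℕ} (h : p < T) : point T p = p := if_pos h

@[simp]
theorem point_self (T : ℕ) : point T T = ⊤ := if_neg (lt_irrefl T)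

theorem point_le_point {T p q : ℕ} (h : p ≤ q) : point T p ≤ point T q := by
  unfold point
  split_ifs with h1 h2 h2
  · exact_mod_cast h
  · exact le_top
  · omega
  · exact le_rfl

theorem point_lt_point {T p q : ℕ} (h : p < q) (hq : q ≤ T) : point T p < point T q := by
  rw [point_of_lt (h.trans_le hq)]
  unfold point
  split_ifs
  · exact_mod_cast h
  · exact ENat.natCast_lt_top p

theorem point_eq_top_iff {T p : ℕ} (hp : p ≤ T) : point T p = ⊤ ↔ p = T := by
  constructor
  · intro h
    by_contra hne
    rw [point_of_lt (lt_of_le_of_ne hp hne)] at h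
    exact ENat.natCast_ne_top _ h
  · rintro rfl
    exact point_self _

theorem point_le_point_iff {T p q : ℕ} (hp : p ≤ T) : point T p ≤ point T q ↔ p ≤ q := by
  refine ⟨fun h => ?_, point_le_point⟩
  by_contra hlt
  exact absurd h (not_le.2 (point_lt_point (not_le.1 hlt) hp))

theorem point_injective {T p q : ℕ} (hp : p ≤ T) (hq : q ≤ T) (h : point T p = point T q) :
    p = q :=
  le_antisymm ((point_le_point_iff hp).1 h.le) ((point_le_point_iff hq).1 h.ge)

/-- The warp `f` takes the values prescribed by the row `U`, which records whether `f` takes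
the value `ω` at a finite point. -/
structure Represents (T : ℕ) (U : ℕ → ℕ) (f : TimeWarp) : Prop where
  total : U T ≤ T
  value : ∀ p ≤ T, U p ≤ T → f (point T p) = point T (U p)
  reaches : f.ReachesTop → Reaches T U

namespace Represents

variable {T : ℕ} {U A B : ℕ → ℕ} {f g : TimeWarp}

theorem apply_top (h : Represents T U f) : f ⊤ = point T (U T) := by
  simpa using h.value T le_rfl h.total

theorem apply_top_eq_top_iff (h : Represents T U f) : f ⊤ = ⊤ ↔ U T = T := by
  rw [h.apply_top, point_eq_top_iff h.total]

theorem apply_top_ne_top_iff (h : Represents T U f) : f ⊤ ≠ ⊤ ↔ U T < T := by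
  rw [Ne, h.apply_top_eq_top_iff]
  have := h.total
  omega

theorem value_nat (h : Represents T U f) {p : ℕ} (hp : p < T) (hU : U p ≤ T) :
    f p = point T (U p) := by
  rw [← point_of_lt hp]
  exact h.value p hp.le hU

theorem reachesTop_iff (h : Represents T U f) : f.ReachesTop ↔ Reaches T U := by
  refine ⟨h.reaches, ?_⟩
  rintro ⟨m, hm, hU⟩
  exact ⟨m, by rw [h.value_nat hm hU.le, hU, point_self]⟩

theorem id (hT : U T ≤ T) (hU : IsId T U) : Represents T U (sSupHom.id ℕ∞) where
  total := hT
  value p hp hv := by rw [hU p (by omega) hv]; rfl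
  reaches := fun ⟨n, hn⟩ => absurd hn (ENat.natCast_ne_top n)

/-- The assumption `0 < T` makes the entry `0` stand for `0`; for `T = 0` it would stand for `ω`. -/
theorem bot (hT : U T ≤ T) (h0 : 0 < T) (hU : IsBot T U) :
    Represents T U (⊥ : TimeWarp) where
  total := hT
  value p hp hv := by
    rw [hU p (by omega) hv, point_of_lt h0]
    rfl
  reaches := fun ⟨n, hn⟩ => by
    rw [sSupHom.bot_apply] at hn
    exact absurd hn (by simp)

theorem top (hT : U T ≤ T) (h0 : 0 < T) (hU : IsTop T U) :
    Represents T U (⊤ : TimeWarp) where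
  total := hT
  value p hp hv := by
    rw [TimeWarp.top_apply]
    rcases hU.1 p (by omega) hv with ⟨rfl, h⟩ | ⟨hne, h⟩
    · simp [h, point_of_lt h0]
    · rw [h, point_self, if_neg]
      intro he
      rw [← Nat.cast_zero, ← point_of_lt h0] at he
      exact hne (point_injective hp h0.le he)
  reaches _ := hU.2

theorem meet (hT : U T ≤ T) (hU : IsMeet T U A B) (hf : Represents T A f)
    (hg : Represents T B g) : Represents T U (f ⊓ g) where
  total := hT
  value p hp hv := by
    obtain ⟨h1, h2, h3⟩ := hU.1 p (by omega) hv
    rw [TimeWarp.inf_apply, hf.value p hp h1, hg.value p hp h2, h3]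
    rcases le_total (A p) (B p) with h | h
    · rw [min_eq_left h, inf_eq_left.2 (point_le_point h)]
    · rw [min_eq_right h, inf_eq_right.2 (point_le_point h)]
  reaches h := by
    rw [TimeWarp.reachesTop_inf] at h
    exact hU.2 (hf.reaches h.1) (hg.reaches h.2)

theorem join (hT : U T ≤ T) (hU : IsJoin T U A B) (hf : Represents T A f)
    (hg : Represents T B g) : Represents T U (f ⊔ g) where
  total := hT
  value p hp hv := by
    obtain ⟨h1, h2, h3⟩ := hU.1 p (by omega) hv
    rw [TimeWarp.sup_apply, hf.value p hp h1, hg.value p hp h2, h3]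
    rcases le_total (A p) (B p) with h | h
    · rw [max_eq_right h, sup_eq_right.2 (point_le_point h)]
    · rw [max_eq_left h, sup_eq_left.2 (point_le_point h)]
  reaches h := by
    rw [TimeWarp.reachesTop_sup] at h
    exact hU.2 (h.imp hf.reaches hg.reaches)

theorem comp (hT : U T ≤ T) (hU : IsComp T U A B) (hf : Represents T A f)
    (hg : Represents T B g) : Represents T U (f.comp g) := by
  -- The values come first because the reaching clause of `IsComp` is guarded by `U T = T`, which is
  -- read off from the value at `ω`.
  have hval : ∀ p ≤ T, U p ≤ T → f.comp g (point T p) = point T (U p) := by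
    intro p hp hv
    obtain ⟨h1, h2⟩ := hU.1 p (by omega) hv
    rw [sSupHom.comp_apply, hg.value p hp h1, hf.value _ h1 (h2 ▸ hv), h2]
  refine ⟨hT, hval, fun h => ?_⟩
  rw [TimeWarp.reachesTop_comp] at h
  refine hU.2 ?_ (h.2.imp hf.reaches hg.reaches)
  have := hval T le_rfl hT
  rw [point_self, sSupHom.comp_apply, h.1] at this
  exact (point_eq_top_iff hT).1 this.symm

theorem ld_apply_of_isRes (hf : Represents T A f) {w v n : ℕ} (hn : n ≠ 0)
    (hg : g n = point T w) (hv : v ≤ T) (h : IsRes T A w v) :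
    TimeWarp.ld f g n = point T v := by
  obtain ⟨h1, h2, h3⟩ := h
  refine TimeWarp.ld_apply_eq f g hn ?_ fun hne => ?_
  · rw [hf.value v hv (h2.trans h1), hg]
    exact point_le_point h2
  · have hlt : v < T := lt_of_le_of_ne hv fun he => hne (by rw [he, point_self])
    obtain ⟨h4, h5, h6⟩ := h3 hlt
    -- This needs `v + 1 < T`: the entry `T` stands for `ω`, which is not the successor of the point
    -- `T - 1`.
    have : point T v + 1 = point T (v + 1) := by
      rw [point_of_lt hlt, point_of_lt h4, Nat.cast_add, Nat.cast_one]
    rw [this, hf.value _ h4.le h6, hg]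
    exact point_lt_point h5 h6

theorem ld (hT : U T ≤ T) (h0 : 0 < T) (hU : IsLd T U A B) (hf : Represents T A f)
    (hg : Represents T B g) : Represents T U (TimeWarp.ld f g) where
  total := hT
  value p hp hv := by
    obtain ⟨h1, h2, h3⟩ := hU.1 p (by omega) hv
    rcases eq_or_ne p 0 with rfl | hp0
    · rw [h1 rfl, point_of_lt h0, Nat.cast_zero, TimeWarp.map_zero]
    rcases hp.lt_or_eq with hlt | rfl
    · have h4 := h3 hp0 (by omega)
      rw [point_of_lt hlt]
      exact ld_apply_of_isRes hf hp0 (hg.value_nat hlt h4.1) hv h4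
    by_cases hB : B p = p ∧ ¬ Reaches p B
    · obtain ⟨h4, h5⟩ := h2 rfl hB.1 hB.2
      have hgt := hg.apply_top_eq_top_iff.2 hB.1
      rw [point_self]
      by_cases hA : Reaches p A
      · obtain ⟨h6, h7, h8⟩ := h5 hA
        have hlt : U p < p := by omega
        refine TimeWarp.ld_apply_top_eq f g hgt (fun h => hB.2 (hg.reaches h)) ?_ ?_
        · rw [hf.value _ hv h7.le, Ne, point_eq_top_iff h7.le]
          exact h7.ne
        · have : point p (U p) + 1 = point p (U p + 1) := by
            rw [point_of_lt hlt, point_of_lt h6, Nat.cast_add, Nat.cast_one]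
          rw [this, hf.value _ h6.le h8.le, h8, point_self]
      · rw [h4 hA, point_self]
        exact TimeWarp.ld_apply_top_eq_top f g hgt fun h => hA (hf.reaches h)
    · have h4 := h3 hp0 (by tauto)
      -- The numerator is constant from some finite `n` on, so the residual at `ω` equals the
      -- residual at `n`.
      obtain ⟨n, hn0, hn⟩ := TimeWarp.exists_nat_apply_eq_top (h := g) fun ht => by
        rw [hg.reachesTop_iff]
        rw [hg.apply_top_eq_top_iff] at ht
        tauto
      rw [point_self, TimeWarp.ld_apply_top_eq_nat f hn0 hn]
      exact ld_apply_of_isRes hf hn0 (hn.trans hg.apply_top) hv h4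
  reaches h := by
    rw [TimeWarp.reachesTop_ld, hf.apply_top_ne_top_iff, hg.reachesTop_iff, hf.apply_top,
      hg.apply_top, point_le_point_iff hf.total] at h
    exact hU.2 h.1 h.2

theorem rd (hT : U T ≤ T) (h0 : 0 < T) (hU : IsRd T U A B) (hf : Represents T A f)
    (hg : Represents T B g) : Represents T U (TimeWarp.rd f g) := by
  have hval : ∀ p ≤ T, U p ≤ T → TimeWarp.rd f g (point T p) = point T (U p) := by
    intro p hp hv
    obtain ⟨h1, h2, h3⟩ := hU.1 p (by omega) hv
    rcases eq_or_ne p 0 with rfl | hp0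
    · rw [h1 rfl, point_of_lt h0, Nat.cast_zero, TimeWarp.map_zero]
    rcases lt_or_ge (B T) p with hlt | hle
    · rw [h2 hlt, point_self]
      have hlt' := point_lt_point hlt hp
      rw [← hg.apply_top] at hlt'
      rcases hp.lt_or_eq with hpT | rfl
      · rw [point_of_lt hpT] at hlt' ⊢
        exact TimeWarp.rd_apply_eq_top f g hlt'
      · rw [point_self] at hlt' ⊢
        exact TimeWarp.rd_apply_top_eq_top f g hlt'.ne
    rcases h3 hp0 hle with ⟨rfl, h4, h5⟩ | ⟨k, hk, hk1, h4, h5, h6, h7⟩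
    · rw [h5, point_self, ← hf.apply_top]
      refine TimeWarp.rd_apply_top f g ?_ fun h => h4 (hg.reaches h)
      rw [hg.apply_top_eq_top_iff]
      exact le_antisymm hg.total hle
    · have e : ((k : ℕ∞) + 1) = ((k + 1 : ℕ) : ℕ∞) := by push_cast; rfl
      have hgk : g k = point T (B k) := hg.value_nat hk (by omega)
      have hgk' : g (k + 1) = point T (B (k + 1)) := by
        rw [e]
        exact hg.value_nat hk1 h6
      have hfk : f (k + 1) = point T (U p) := by
        rw [e, h7]
        exact hf.value_nat hk1 (h7 ▸ hv)
      rw [← hfk]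
      rcases hp.lt_or_eq with hpT | rfl
      · rw [point_of_lt hpT]
        refine TimeWarp.rd_apply_eq f g hp0 ?_ ?_
        · rw [hgk, ← point_of_lt hpT]
          exact point_lt_point h4 hp
        · rw [hgk', ← point_of_lt hpT]
          exact point_le_point h5
      · rw [point_self]
        refine TimeWarp.rd_apply_top_eq f g ?_ ?_
        · rw [hgk, Ne, point_eq_top_iff h4.le]
          exact h4.ne
        · rw [hgk', point_eq_top_iff h6]
          exact le_antisymm h6 h5
  refine ⟨hT, hval, fun h => ?_⟩
  rw [TimeWarp.reachesTop_rd, hf.reachesTop_iff, hg.reachesTop_iff, hg.apply_top_ne_top_iff] at h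
  refine hU.2 ?_ h.2
  have := hval T le_rfl hT
  rw [point_self, h.1] at this
  exact (point_eq_top_iff hT).1 this.symm

end Represents

/-! ### Extending variable rows to time warps. -/

open Classical in
/-- The values of a warp that is represented by a variable row: the largest value of the row
up to the given point, and the identity beyond `T` if `ω` is to be reached only at `ω`. -/
noncomputable def varSeq (T : ℕ) (U : ℕ → ℕ) (n : ℕ) : ℕ∞ :=
  (⨆ p : ℕ, ⨆ _ : p ≤ n ∧ p < T ∧ U p ≤ T, point T (U p)) ⊔
    (if U T = T ∧ ¬ Reaches T U ∧ T ≤ n then (n : ℕ∞) else 0)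

theorem varSeq_monotone (T : ℕ) (U : ℕ → ℕ) : Monotone (varSeq T U) := by
  intro m n hmn
  refine sup_le_sup (iSup_mono fun p => iSup_mono' fun hp => ⟨⟨hp.1.trans hmn, hp.2⟩, le_rfl⟩) ?_
  split_ifs with h1 h2
  · exact_mod_cast hmn
  · exact absurd ⟨h1.1, h1.2.1, h1.2.2.trans hmn⟩ h2
  · exact zero_le
  · exact le_rfl

theorem le_varSeq {T p n : ℕ} {U : ℕ → ℕ} (hpn : p ≤ n) (hp : p < T) (hU : U p ≤ T) :
    point T (U p) ≤ varSeq T U n :=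
  le_sup_of_le_left (le_iSup₂ (f := fun p (_ : p ≤ n ∧ p < T ∧ U p ≤ T) => point T (U p)) p
    ⟨hpn, hp, hU⟩)

theorem varSeq_zero {T : ℕ} {U : ℕ → ℕ} (h0 : 0 < T) (hU : IsVar T U) : varSeq T U 0 = 0 := by
  refine le_antisymm (sup_le (iSup₂_le fun p hp => ?_) ?_) zero_le
  · have := (hU.1 p (by omega) hp.2.2).1 (by omega)
    rw [this, point_of_lt h0, Nat.cast_zero]
  · split_ifs <;> simp

theorem varSeq_apply {T p : ℕ} {U : ℕ → ℕ} (hU : IsVar T U) (hp : p < T) (hv : U p ≤ T) :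
    varSeq T U p = point T (U p) := by
  refine le_antisymm (sup_le (iSup₂_le fun q hq => ?_) ?_) (le_varSeq le_rfl hp hv)
  · exact point_le_point ((hU.1 q (by omega) hq.2.2).2 p (by omega) hq.1 hv)
  · rw [if_neg (by omega)]
    exact zero_le

/-- If no finite point of the row has the entry `T`, its defined entries at finite points are below
`T`, and the identity part contributes at most `n`; so `T + n` bounds the sequence at `n`. -/
theorem reaches_of_varSeq_eq_top {T n : ℕ} {U : ℕ → ℕ} (h : varSeq T U n = ⊤) :
    Reaches T U := by
  by_contra hR
  refine absurd h (ne_of_lt ?_)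
  have hlt : varSeq T U n ≤ ((T + n : ℕ) : ℕ∞) := by
    refine sup_le (iSup₂_le fun p hp => ?_) ?_
    · have : U p < T := lt_of_le_of_ne hp.2.2 fun he => hR ⟨p, hp.2.1, he⟩
      rw [point_of_lt this]
      exact_mod_cast (by omega : U p ≤ T + n)
    · split_ifs
      · exact_mod_cast (by omega : n ≤ T + n)
      · exact zero_le
  exact lt_of_le_of_lt hlt (ENat.natCast_lt_top _)

theorem exists_represents_of_isVar {T : ℕ} {U : ℕ → ℕ} (hT : U T ≤ T) (h0 : 0 < T)
    (hU : IsVar T U) : ∃ f : TimeWarp, Represents T U f := by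
  have happ := TimeWarp.ofSeq_apply_nat (varSeq T U) (varSeq_zero h0 hU) (varSeq_monotone T U)
  refine ⟨TimeWarp.ofSeq (varSeq T U) (varSeq_zero h0 hU), hT, fun p hp hv => ?_, ?_⟩
  · rcases hp.lt_or_eq with hlt | rfl
    · rw [point_of_lt hlt, happ, varSeq_apply hU hlt hv]
    · rw [point_self, TimeWarp.apply_top]
      simp only [happ]
      refine le_antisymm (iSup_le fun n => sup_le (iSup₂_le fun q hq => ?_) ?_) ?_
      · exact point_le_point ((hU.1 q (by omega) hq.2.2).2 p (by omega) hq.2.1.le hv)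
      · split_ifs with h
        · rw [h.1, point_self]
          exact le_top
        · exact zero_le
      · have hm : ∀ m < p, U m = U p → point p (U p) ≤ ⨆ n, varSeq p U n := fun m hm he => by
          rw [← he]
          exact (le_varSeq le_rfl hm (he ▸ hv)).trans (le_iSup _ m)
        -- If `ω` is attained at a finite point, monotonicity forces the last entry to be `ω` too.
        -- If it is not but the last entry is `ω`, the identity part of `varSeq` supplies the
        -- supremum. A finite last entry is attained by the continuity clause.
        by_cases hR : Reaches p U
        · obtain ⟨m, hmp, he⟩ := hR
          have : U p = p := le_antisymm hv (he ▸
            (hU.1 m (by omega) he.le).2 p (by omega) hmp.le hv)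
          exact hm m hmp (he.trans this.symm)
        · rcases hU.2 with hUp | ⟨m, hmp, he⟩
          · rw [hUp, point_self]
            refine (ENat.eq_top_iff_forall_ge.2 fun n => ?_).ge
            refine le_trans ?_ (le_iSup _ (n + p))
            refine le_sup_of_le_right ?_
            rw [if_pos ⟨hUp, hR, by omega⟩]
            exact_mod_cast (by omega : n ≤ n + p)
          · exact hm m hmp he
  · rintro ⟨n, hn⟩
    rw [happ] at hn
    exact reaches_of_varSeq_eq_top hn

end Row

/-! ### Certificates and their soundness. -/

namespace Row

/-- A system of rows for the terms with code at most `N`. -/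
def IsCertificate (N T : ℕ) (V : ℕ → ℕ → ℕ) : Prop :=
  (∀ u < N + 1, V u T ≤ T) ∧ IsId T (V 0) ∧ IsBot T (V 1) ∧ IsTop T (V 2) ∧
  ∀ k < N + 1,
    (6 * k + 3 ≤ N → IsVar T (V (6 * k + 3))) ∧
    (6 * k + 4 ≤ N → IsMeet T (V (6 * k + 4)) (V k.unpair.1) (V k.unpair.2)) ∧
    (6 * k + 5 ≤ N → IsJoin T (V (6 * k + 5)) (V k.unpair.1) (V k.unpair.2)) ∧
    (6 * k + 6 ≤ N → IsComp T (V (6 * k + 6)) (V k.unpair.1) (V k.unpair.2)) ∧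
    (6 * k + 7 ≤ N → IsLd T (V (6 * k + 7)) (V k.unpair.1) (V k.unpair.2)) ∧
    (6 * k + 8 ≤ N → IsRd T (V (6 * k + 8)) (V k.unpair.1) (V k.unpair.2))

/-- Only the variable rows require a choice of warps. All other rows follow by induction on terms,
as the subterms of a compound term have smaller codes. -/
theorem IsCertificate.exists_represents {N T : ℕ} {V : ℕ → ℕ → ℕ} (h0 : 0 < T)
    (hV : IsCertificate N T V) :
    ∃ θ : ℕ → TimeWarp, ∀ t : WarpTerm, t.code ≤ N → Represents T (V t.code) (t.eval θ) := by
  obtain ⟨htot, hid, hbot, htop, hop⟩ := hV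
  have hvar : ∀ n, ∃ f : TimeWarp, 6 * n + 3 ≤ N → Represents T (V (6 * n + 3)) f := by
    intro n
    by_cases hn : 6 * n + 3 ≤ N
    · obtain ⟨f, hf⟩ := exists_represents_of_isVar (htot _ (by omega)) h0
        ((hop n (by omega)).1 hn)
      exact ⟨f, fun _ => hf⟩
    · exact ⟨⊥, fun h => absurd h hn⟩
  choose θ hθ using hvar
  have hpair : ∀ {s t : WarpTerm} {i : ℕ}, 6 * Nat.pair s.code t.code + i ≤ N →
      Nat.pair s.code t.code < N + 1 ∧ s.code ≤ N ∧ t.code ≤ N := by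
    intro s t i h
    have h1 := Nat.left_le_pair s.code t.code
    have h2 := Nat.right_le_pair s.code t.code
    omega
  refine ⟨θ, fun t => ?_⟩
  induction t with
  | var n => exact hθ n
  | id => exact fun h => .id (htot _ (by omega)) hid
  | bot => exact fun h => .bot (htot _ (by omega)) h0 hbot
  | top => exact fun h => .top (htot _ (by omega)) h0 htop
  | meet s t hs ht =>
    intro h
    obtain ⟨hk, h1, h2⟩ := hpair h
    have := (hop _ hk).2.1 h
    rw [Nat.unpair_pair] at this
    exact .meet (htot _ (by omega)) this (hs h1) (ht h2)
  | join s t hs ht =>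
    intro h
    obtain ⟨hk, h1, h2⟩ := hpair h
    have := (hop _ hk).2.2.1 h
    rw [Nat.unpair_pair] at this
    exact .join (htot _ (by omega)) this (hs h1) (ht h2)
  | comp s t hs ht =>
    intro h
    obtain ⟨hk, h1, h2⟩ := hpair h
    have := (hop _ hk).2.2.2.1 h
    rw [Nat.unpair_pair] at this
    exact .comp (htot _ (by omega)) this (hs h1) (ht h2)
  | ld s t hs ht =>
    intro h
    obtain ⟨hk, h1, h2⟩ := hpair h
    have := (hop _ hk).2.2.2.2.1 h
    rw [Nat.unpair_pair] at this
    exact .ld (htot _ (by omega)) h0 this (hs h1) (ht h2)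
  | rd s t hs ht =>
    intro h
    obtain ⟨hk, h1, h2⟩ := hpair h
    have := (hop _ hk).2.2.2.2.2 h
    rw [Nat.unpair_pair] at this
    exact .rd (htot _ (by omega)) h0 this (hs h1) (ht h2)

/-! ### Completeness of the local conditions: rows sampled from actual warps. -/

/-- `π` maps the points of `S` to `{0, …, T}`, preserving the order, `0`, `ω` and
successors. -/
structure Collapse (S : Set ℕ∞) (T : ℕ) (π : ℕ∞ → ℕ) : Prop where
  zero_mem : 0 ∈ S
  top_mem : ⊤ ∈ S
  map_zero : π 0 = 0
  map_top : π ⊤ = T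
  le_iff : ∀ x ∈ S, ∀ y ∈ S, (π x ≤ π y ↔ x ≤ y)
  map_add_one : ∀ x ∈ S, x + 1 ∈ S → x ≠ ⊤ → π (x + 1) = π x + 1

namespace Collapse

variable {S : Set ℕ∞} {T : ℕ} {π : ℕ∞ → ℕ} {x y : ℕ∞}

theorem le_top (h : Collapse S T π) (hx : x ∈ S) : π x ≤ T := by
  rw [← h.map_top, h.le_iff x hx ⊤ h.top_mem]
  exact _root_.le_top

theorem lt_iff (h : Collapse S T π) (hx : x ∈ S) (hy : y ∈ S) : π x < π y ↔ x < y := by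
  rw [← not_le, h.le_iff y hy x hx, not_le]

theorem eq_iff (h : Collapse S T π) (hx : x ∈ S) (hy : y ∈ S) : π x = π y ↔ x = y := by
  rw [le_antisymm_iff, h.le_iff y hy x hx, h.le_iff x hx y hy, ← le_antisymm_iff]

theorem eq_top_iff (h : Collapse S T π) (hx : x ∈ S) : π x = T ↔ x = ⊤ := by
  rw [← h.map_top, h.eq_iff hx h.top_mem]

theorem lt_top_iff (h : Collapse S T π) (hx : x ∈ S) : π x < T ↔ x ≠ ⊤ := by
  rw [← h.map_top, h.lt_iff hx h.top_mem, _root_.lt_top_iff_ne_top]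

theorem eq_zero_iff (h : Collapse S T π) (hx : x ∈ S) : π x = 0 ↔ x = 0 := by
  rw [← h.map_zero, h.eq_iff hx h.zero_mem]

end Collapse

/-- The row `U` is defined at the images under `π` of the points in `D`, where it has the
images of the values of `f`. -/
structure Samples (S : Set ℕ∞) (T : ℕ) (π : ℕ∞ → ℕ) (D : Set ℕ∞) (f : TimeWarp)
    (U : ℕ → ℕ) : Prop where
  subset : D ⊆ S
  apply_mem : ∀ x ∈ D, f x ∈ S
  value : ∀ x ∈ D, U (π x) = π (f x)
  dom : ∀ p ≤ T, U p ≤ T → ∃ x ∈ D, π x = p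
  top_mem : ⊤ ∈ D
  witness : f.ReachesTop → ∃ n : ℕ, (n : ℕ∞) ∈ D ∧ f n = ⊤

namespace Samples

variable {S D DA DB : Set ℕ∞} {T : ℕ} {π : ℕ∞ → ℕ} {f g : TimeWarp} {U A B : ℕ → ℕ}

theorem value_top (hπ : Collapse S T π) (h : Samples S T π D f U) : U T = π (f ⊤) := by
  rw [← hπ.map_top, h.value ⊤ h.top_mem]

theorem value_top_le (hπ : Collapse S T π) (h : Samples S T π D f U) : U T ≤ T := by
  rw [h.value_top hπ]
  exact hπ.le_top (h.apply_mem ⊤ h.top_mem)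

theorem value_le (hπ : Collapse S T π) (h : Samples S T π D f U) {x : ℕ∞} (hx : x ∈ D) :
    U (π x) ≤ T := by
  rw [h.value x hx]
  exact hπ.le_top (h.apply_mem x hx)

theorem value_top_eq_iff (hπ : Collapse S T π) (h : Samples S T π D f U) :
    U T = T ↔ f ⊤ = ⊤ := by
  rw [h.value_top hπ, hπ.eq_top_iff (h.apply_mem ⊤ h.top_mem)]

theorem value_top_lt_iff (hπ : Collapse S T π) (h : Samples S T π D f U) :
    U T < T ↔ f ⊤ ≠ ⊤ := by
  rw [h.value_top hπ, hπ.lt_top_iff (h.apply_mem ⊤ h.top_mem)]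

/-- The field `dom` excludes entries that come from no sampled point, and `witness` guarantees that
attaining `ω` is visible among the samples. -/
theorem reaches_iff (hπ : Collapse S T π) (h : Samples S T π D f U) :
    Reaches T U ↔ f.ReachesTop := by
  constructor
  · rintro ⟨m, hm, hU⟩
    obtain ⟨x, hx, rfl⟩ := h.dom m hm.le hU.le
    rw [h.value x hx, hπ.eq_top_iff (h.apply_mem x hx)] at hU
    obtain ⟨n, rfl⟩ := ENat.ne_top_iff_exists.1 ((hπ.lt_top_iff (h.subset hx)).1 hm)
    exact ⟨n, hU⟩
  · intro hr
    obtain ⟨n, hn, hf⟩ := h.witness hr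
    refine ⟨π n, (hπ.lt_top_iff (h.subset hn)).2 (ENat.natCast_ne_top n), ?_⟩
    rw [h.value _ hn, hf, hπ.map_top]

theorem isId (h : Samples S T π D (sSupHom.id ℕ∞) U) : IsId T U := by
  intro p hp hv
  obtain ⟨x, hx, rfl⟩ := h.dom p (by omega) hv
  rw [h.value x hx]
  rfl

theorem isBot (hπ : Collapse S T π) (h : Samples S T π D (⊥ : TimeWarp) U) : IsBot T U := by
  intro p hp hv
  obtain ⟨x, hx, rfl⟩ := h.dom p (by omega) hv
  rw [h.value x hx, sSupHom.bot_apply]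
  exact hπ.map_zero

theorem isTop (hπ : Collapse S T π) (h : Samples S T π D (⊤ : TimeWarp) U) : IsTop T U := by
  constructor
  · intro p hp hv
    obtain ⟨x, hx, rfl⟩ := h.dom p (by omega) hv
    rw [h.value x hx, Ne, hπ.eq_zero_iff (h.subset hx), TimeWarp.top_apply]
    by_cases h0 : x = 0
    · left
      rw [if_pos h0]
      exact ⟨h0, hπ.map_zero⟩
    · right
      rw [if_neg h0]
      exact ⟨h0, hπ.map_top⟩
  · rw [h.reaches_iff hπ]
    exact ⟨1, by rw [TimeWarp.top_apply]; simp⟩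

theorem isVar (hπ : Collapse S T π) (h : Samples S T π D f U)
    (hw : f ⊤ ≠ ⊤ → ∃ n : ℕ, (n : ℕ∞) ∈ D ∧ f n = f ⊤) : IsVar T U := by
  constructor
  · intro p hp hv
    obtain ⟨x, hx, rfl⟩ := h.dom p (by omega) hv
    constructor
    · rw [hπ.eq_zero_iff (h.subset hx), h.value x hx]
      rintro rfl
      rw [TimeWarp.map_zero, hπ.map_zero]
    · intro q hq hle hv'
      obtain ⟨y, hy, rfl⟩ := h.dom q (by omega) hv'
      rw [h.value x hx, h.value y hy, hπ.le_iff _ (h.apply_mem x hx) _ (h.apply_mem y hy)]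
      exact f.mono ((hπ.le_iff _ (h.subset hx) _ (h.subset hy)).1 hle)
  · rw [h.value_top_eq_iff hπ, or_iff_not_imp_left]
    intro ht
    obtain ⟨n, hn, hf⟩ := hw ht
    refine ⟨π n, (hπ.lt_top_iff (h.subset hn)).2 (ENat.natCast_ne_top n), ?_⟩
    rw [h.value _ hn, hf, h.value_top hπ]

theorem isMeet (hπ : Collapse S T π) (h : Samples S T π D (f ⊓ g) U)
    (hf : Samples S T π DA f A) (hg : Samples S T π DB g B) (hA : D ⊆ DA) (hB : D ⊆ DB) :
    IsMeet T U A B := by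
  constructor
  · intro p hp hv
    obtain ⟨x, hx, rfl⟩ := h.dom p (by omega) hv
    refine ⟨hf.value_le hπ (hA hx), hg.value_le hπ (hB hx), ?_⟩
    rw [h.value x hx, hf.value x (hA hx), hg.value x (hB hx), TimeWarp.inf_apply]
    have hle := hπ.le_iff _ (hf.apply_mem x (hA hx)) _ (hg.apply_mem x (hB hx))
    have hge := hπ.le_iff _ (hg.apply_mem x (hB hx)) _ (hf.apply_mem x (hA hx))
    rcases le_total (f x) (g x) with hfg | hfg
    · rw [inf_eq_left.2 hfg, min_eq_left (hle.2 hfg)]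
    · rw [inf_eq_right.2 hfg, min_eq_right (hge.2 hfg)]
  · rw [h.reaches_iff hπ, hf.reaches_iff hπ, hg.reaches_iff hπ, TimeWarp.reachesTop_inf]
    exact And.intro

theorem isJoin (hπ : Collapse S T π) (h : Samples S T π D (f ⊔ g) U)
    (hf : Samples S T π DA f A) (hg : Samples S T π DB g B) (hA : D ⊆ DA) (hB : D ⊆ DB) :
    IsJoin T U A B := by
  constructor
  · intro p hp hv
    obtain ⟨x, hx, rfl⟩ := h.dom p (by omega) hv
    refine ⟨hf.value_le hπ (hA hx), hg.value_le hπ (hB hx), ?_⟩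
    rw [h.value x hx, hf.value x (hA hx), hg.value x (hB hx), TimeWarp.sup_apply]
    have hle := hπ.le_iff _ (hf.apply_mem x (hA hx)) _ (hg.apply_mem x (hB hx))
    have hge := hπ.le_iff _ (hg.apply_mem x (hB hx)) _ (hf.apply_mem x (hA hx))
    rcases le_total (f x) (g x) with hfg | hfg
    · rw [sup_eq_right.2 hfg, max_eq_right (hle.2 hfg)]
    · rw [sup_eq_left.2 hfg, max_eq_left (hge.2 hfg)]
  · rw [h.reaches_iff hπ, hf.reaches_iff hπ, hg.reaches_iff hπ, TimeWarp.reachesTop_sup]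
    exact fun h => h

theorem isComp (hπ : Collapse S T π) (h : Samples S T π D (f.comp g) U)
    (hf : Samples S T π DA f A) (hg : Samples S T π DB g B) (hB : D ⊆ DB)
    (hA : ∀ x ∈ D, g x ∈ DA) : IsComp T U A B := by
  constructor
  · intro p hp hv
    obtain ⟨x, hx, rfl⟩ := h.dom p (by omega) hv
    refine ⟨hg.value_le hπ (hB hx), ?_⟩
    rw [h.value x hx, hg.value x (hB hx), hf.value _ (hA x hx), sSupHom.comp_apply]
  · rw [h.reaches_iff hπ, hf.reaches_iff hπ, hg.reaches_iff hπ, h.value_top_eq_iff hπ,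
      TimeWarp.reachesTop_comp, sSupHom.comp_apply]
    exact And.intro

/-- Maximality of a residual value is checked at its successor, so both points must be sampled in
the row of `f`. -/
theorem isLd (hπ : Collapse S T π) (h : Samples S T π D (TimeWarp.ld f g) U)
    (hf : Samples S T π DA f A) (hg : Samples S T π DB g B) (hB : D ⊆ DB)
    (hA : ∀ x ∈ D, TimeWarp.ld f g x ∈ DA ∧ TimeWarp.ld f g x + 1 ∈ DA) : IsLd T U A B := by
  have hsucc : ∀ x ∈ D, TimeWarp.ld f g x ≠ ⊤ →
      π (TimeWarp.ld f g x) + 1 = π (TimeWarp.ld f g x + 1) ∧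
        π (TimeWarp.ld f g x + 1) < T := by
    intro x hx hne
    obtain ⟨h1, h2⟩ := hA x hx
    refine ⟨(hπ.map_add_one _ (hf.subset h1) (hf.subset h2) hne).symm,
      (hπ.lt_top_iff (hf.subset h2)).2 ?_⟩
    simpa using hne
  constructor
  · intro p hp hv
    obtain ⟨x, hx, rfl⟩ := h.dom p (by omega) hv
    obtain ⟨hA1, hA2⟩ := hA x hx
    have hxS := h.subset hx
    rw [Ne, hπ.eq_zero_iff hxS, hπ.eq_top_iff hxS, hg.value_top_eq_iff hπ, hg.reaches_iff hπ,
      h.value x hx, hg.value x (hB hx), h.value_top hπ]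
    refine ⟨?_, ?_, ?_⟩
    · rintro rfl
      rw [TimeWarp.map_zero, hπ.map_zero]
    · rintro rfl hgt hgr
      unfold IsLimRes
      rw [hf.reaches_iff hπ]
      refine ⟨fun hfr => ?_, fun hfr => ?_⟩
      · rw [TimeWarp.ld_apply_top_eq_top f g hgt hfr, hπ.map_top]
      · obtain ⟨n, hn⟩ := hfr
        obtain ⟨k, hk, hk'⟩ :=
          TimeWarp.exists_apply_lt_le_apply_add_one (by simp) n hn.symm.le
        have hk' := top_le_iff.1 hk'
        have hld : TimeWarp.ld f g ⊤ = k := TimeWarp.ld_apply_top_eq f g hgt hgr hk.ne hk'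
        obtain ⟨h1, h2⟩ := hsucc ⊤ hx (hld ▸ ENat.natCast_ne_top k)
        rw [h1, hf.value _ hA1, hf.value _ hA2, hπ.lt_top_iff (hf.apply_mem _ hA1), hld, hk',
          hπ.map_top]
        exact ⟨hld ▸ h2, hk.ne, rfl⟩
    · intro hx0 hlim
      obtain ⟨n, hn0, hgn, hldn⟩ : ∃ n : ℕ, n ≠ 0 ∧ g n = g x ∧
          TimeWarp.ld f g n = TimeWarp.ld f g x := by
        by_cases hxt : x = ⊤
        · obtain ⟨n, hn0, hn⟩ := TimeWarp.exists_nat_apply_eq_top (h := g) (by tauto)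
          rw [hxt]
          exact ⟨n, hn0, hn, (TimeWarp.ld_apply_top_eq_nat f hn0 hn).symm⟩
        · obtain ⟨n, rfl⟩ := ENat.ne_top_iff_exists.1 hxt
          exact ⟨n, by simpa using hx0, rfl, rfl⟩
      have hgS := hg.apply_mem x (hB hx)
      refine ⟨hπ.le_top hgS, ?_, fun hlt => ?_⟩
      · rw [hf.value _ hA1, hπ.le_iff _ (hf.apply_mem _ hA1) _ hgS, ← hgn, ← hldn]
        exact TimeWarp.apply_ld_le f g hn0
      · have hne := (hπ.lt_top_iff (hf.subset hA1)).1 hlt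
        obtain ⟨h1, h2⟩ := hsucc x hx hne
        rw [h1]
        refine ⟨h2, ?_, hf.value_le hπ hA2⟩
        rw [hf.value _ hA2, hπ.lt_iff hgS (hf.apply_mem _ hA2), ← hgn, ← hldn]
        exact TimeWarp.lt_apply_ld_add_one f g hn0 (hldn ▸ hne)
  · rw [h.reaches_iff hπ, hg.reaches_iff hπ, hf.value_top_lt_iff hπ, TimeWarp.reachesTop_ld,
      hf.value_top hπ, hg.value_top hπ,
      hπ.le_iff _ (hf.apply_mem ⊤ hf.top_mem) _ (hg.apply_mem ⊤ hg.top_mem)]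
    exact And.intro

/-- The row of `g` must show the jump across `x` between `k` and `k + 1`, and the row of `f` the
value at `k + 1`. -/
theorem isRd (hπ : Collapse S T π) (h : Samples S T π D (TimeWarp.rd f g) U)
    (hf : Samples S T π DA f A) (hg : Samples S T π DB g B)
    (hk : ∀ x ∈ D, ∀ k : ℕ, g k < x → x ≤ g (k + 1) →
      (k : ℕ∞) ∈ DB ∧ (k : ℕ∞) + 1 ∈ DB ∧ (k : ℕ∞) + 1 ∈ DA) : IsRd T U A B := by
  constructor
  · intro p hp hv
    obtain ⟨x, hx, rfl⟩ := h.dom p (by omega) hv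
    have hxS := h.subset hx
    have hgS := hg.apply_mem ⊤ hg.top_mem
    rw [Ne, hπ.eq_zero_iff hxS, hπ.eq_top_iff hxS, hg.reaches_iff hπ, h.value x hx,
      hg.value_top hπ, hf.value_top hπ, h.value_top hπ, hπ.lt_iff hgS hxS, hπ.le_iff _ hxS _ hgS]
    refine ⟨?_, ?_, ?_⟩
    · rintro rfl
      rw [TimeWarp.map_zero, hπ.map_zero]
    · intro hlt
      rw [hπ.eq_top_iff (h.apply_mem x hx)]
      by_cases hxt : x = ⊤
      · rw [hxt] at hlt ⊢
        exact TimeWarp.rd_apply_top_eq_top f g hlt.ne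
      · obtain ⟨n, rfl⟩ := ENat.ne_top_iff_exists.1 hxt
        exact TimeWarp.rd_apply_eq_top f g hlt
    · intro hx0 hle
      by_cases hc : x = ⊤ ∧ ¬ g.ReachesTop
      · left
        obtain ⟨rfl, hgr⟩ := hc
        refine ⟨rfl, hgr, ?_⟩
        rw [TimeWarp.rd_apply_top f g (top_le_iff.1 hle) hgr]
      · right
        obtain ⟨n, hn⟩ : ∃ n : ℕ, x ≤ g n := by
          by_cases hxt : x = ⊤
          · obtain ⟨n, hn⟩ : g.ReachesTop := by tauto
            exact ⟨n, le_top.trans hn.symm.le⟩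
          · exact TimeWarp.exists_le_apply hxt hle
        obtain ⟨k, h1, h2⟩ := TimeWarp.exists_apply_lt_le_apply_add_one hx0 n hn
        obtain ⟨hkB, hkB', hkA⟩ := hk x hx k h1 h2
        have hne : (k : ℕ∞) ≠ ⊤ := ENat.natCast_ne_top k
        have hadd := hπ.map_add_one _ (hg.subset hkB) (hg.subset hkB') hne
        refine ⟨π k, (hπ.lt_top_iff (hg.subset hkB)).2 hne, ?_⟩
        rw [← hadd, hπ.lt_top_iff (hg.subset hkB'), hg.value _ hkB, hg.value _ hkB',
          hf.value _ hkA, hπ.lt_iff (hg.apply_mem _ hkB) hxS,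
          hπ.le_iff _ hxS _ (hg.apply_mem _ hkB')]
        refine ⟨by simp, h1, h2, hπ.le_top (hg.apply_mem _ hkB'), ?_⟩
        by_cases hxt : x = ⊤
        · subst hxt
          rw [TimeWarp.rd_apply_top_eq f g h1.ne (top_le_iff.1 h2)]
        · obtain ⟨m, rfl⟩ := ENat.ne_top_iff_exists.1 hxt
          rw [TimeWarp.rd_apply_eq f g (by simpa using hx0) h1 h2]
  · rw [h.reaches_iff hπ, hg.reaches_iff hπ, hf.reaches_iff hπ, h.value_top_eq_iff hπ,
      hg.value_top_lt_iff hπ, TimeWarp.reachesTop_rd]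
    exact And.intro

end Samples

end Row

namespace WarpTerm

theorem ofCode_six_mul (k : ℕ) :
    ofCode (6 * k + 3) = var k ∧
    ofCode (6 * k + 4) = meet (ofCode k.unpair.1) (ofCode k.unpair.2) ∧
    ofCode (6 * k + 5) = join (ofCode k.unpair.1) (ofCode k.unpair.2) ∧
    ofCode (6 * k + 6) = comp (ofCode k.unpair.1) (ofCode k.unpair.2) ∧
    ofCode (6 * k + 7) = ld (ofCode k.unpair.1) (ofCode k.unpair.2) ∧
    ofCode (6 * k + 8) = rd (ofCode k.unpair.1) (ofCode k.unpair.2) := by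
  have e (t : WarpTerm) (n : ℕ) (h : t.code = n) : ofCode n = t := by rw [← h, ofCode_code]
  refine ⟨e _ _ ?_, e _ _ ?_, e _ _ ?_, e _ _ ?_, e _ _ ?_, e _ _ ?_⟩ <;>
    simp [code, code_ofCode, Nat.pair_unpair]

end WarpTerm

/-! ### Bounded sets of sample points, and their ranks. -/

namespace Row

/-- The least point with image at least `x`. -/
noncomputable def leastGe (f : TimeWarp) (x : ℕ∞) : ℕ∞ := sInf {l | x ≤ f l}

theorem leastGe_eq {f : TimeWarp} {x : ℕ∞} {k : ℕ} (h : f k < x) (h' : x ≤ f (k + 1)) :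
    leastGe f x = k + 1 := by
  refine le_antisymm (sInf_le h') (le_sInf fun l hl => Order.add_one_le_of_lt ?_)
  exact not_le.1 fun hle => absurd (hl.trans (f.mono hle)) (not_le.2 h)

open Classical in
/-- The points that have to be sampled for the evaluation at the points of `P` of operations
with the warps `W 0, …, W N`. -/
noncomputable def demand (N : ℕ) (W : ℕ → TimeWarp) (P : Finset ℕ∞) : Finset ℕ∞ :=
  P ∪ (Finset.range (N + 1) ×ˢ P).biUnion fun q =>
    {W q.1 q.2, W q.1 q.2 + 1, leastGe (W q.1) q.2, leastGe (W q.1) q.2 - 1}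

/-- Besides `P` itself there are four points for each of the `N + 1` warps and each point of `P`,
and `1 + 4 * (N + 1) = 4 * N + 5`. -/
theorem card_demand_le (N : ℕ) (W : ℕ → TimeWarp) (P : Finset ℕ∞) :
    (demand N W P).card ≤ P.card * (4 * N + 5) := by
  classical
  have h := Finset.card_biUnion_le_card_mul (Finset.range (N + 1) ×ˢ P)
    (fun q => ({W q.1 q.2, W q.1 q.2 + 1, leastGe (W q.1) q.2, leastGe (W q.1) q.2 - 1} :
      Finset ℕ∞)) 4 fun q _ => Finset.card_le_four
  rw [Finset.card_product, Finset.card_range] at h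
  refine (Finset.card_union_le _ _).trans ((Nat.add_le_add_left h _).trans (le_of_eq ?_))
  ring

theorem subset_demand (N : ℕ) (W : ℕ → TimeWarp) (P : Finset ℕ∞) : P ⊆ demand N W P :=
  Finset.subset_union_left

/-- The value serves composition and left residuals, and its successor serves the maximality test
for left residuals. The least preimage bound and its predecessor give the jump needed for right
residuals; the former also locates where a value is first attained. -/
theorem mem_demand {N : ℕ} {W : ℕ → TimeWarp} {P : Finset ℕ∞} {u : ℕ} {x : ℕ∞} (hu : u ≤ N)
    (hx : x ∈ P) : W u x ∈ demand N W P ∧ W u x + 1 ∈ demand N W P ∧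
      leastGe (W u) x ∈ demand N W P ∧ leastGe (W u) x - 1 ∈ demand N W P := by
  have h : (u, x) ∈ Finset.range (N + 1) ×ˢ P := by
    rw [Finset.mem_product, Finset.mem_range]
    exact ⟨by omega, hx⟩
  refine ⟨?_, ?_, ?_, ?_⟩ <;>
    exact Finset.mem_union_right _ (Finset.mem_biUnion.2 ⟨(u, x), h, by simp⟩)

/-- Iterated demands, starting from `0`, `ω` and a given point. -/
noncomputable def level (N : ℕ) (W : ℕ → TimeWarp) (x : ℕ∞) (k : ℕ) : Finset ℕ∞ :=
  (demand N W)^[k] {0, ⊤, x}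

theorem level_succ (N : ℕ) (W : ℕ → TimeWarp) (x : ℕ∞) (k : ℕ) :
    level N W x (k + 1) = demand N W (level N W x k) :=
  Function.iterate_succ_apply' _ _ _

theorem card_level_le (N : ℕ) (W : ℕ → TimeWarp) (x : ℕ∞) (k : ℕ) :
    (level N W x k).card ≤ 3 * (4 * N + 5) ^ k := by
  induction k with
  | zero => simpa [level] using Finset.card_le_three
  | succ k ih =>
    rw [level_succ, pow_succ, ← mul_assoc]
    exact (card_demand_le _ _ _).trans (Nat.mul_le_mul_right _ ih)

theorem level_mono (N : ℕ) (W : ℕ → TimeWarp) (x : ℕ∞) : Monotone (level N W x) :=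
  monotone_nat_of_le_succ fun k => by
    rw [level_succ]
    exact subset_demand N W _

theorem mem_level (N : ℕ) (W : ℕ → TimeWarp) (x : ℕ∞) (k : ℕ) :
    0 ∈ level N W x k ∧ ⊤ ∈ level N W x k ∧ x ∈ level N W x k := by
  have h := level_mono N W x (Nat.zero_le k)
  exact ⟨h (by simp [level]), h (by simp [level]), h (by simp [level])⟩

open Classical in
/-- The rank of a finite point in `S`, and `T` at `ω`. -/
noncomputable def rank (S : Finset ℕ∞) (T : ℕ) (x : ℕ∞) : ℕ :=
  if x = ⊤ then T else (S.filter (· < x)).card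

theorem rank_top (S : Finset ℕ∞) (T : ℕ) : rank S T ⊤ = T := if_pos rfl

theorem rank_lt_rank {S : Finset ℕ∞} {T : ℕ} (hT : S.card ≤ T) {x y : ℕ∞} (hx : x ∈ S)
    (h : x < y) : rank S T x < rank S T y := by
  classical
  rw [rank, if_neg h.ne_top]
  by_cases hy : y = ⊤
  · rw [hy, rank_top]
    refine lt_of_lt_of_le (Finset.card_lt_card ?_) hT
    exact Finset.filter_ssubset.2 ⟨x, hx, lt_irrefl x⟩
  · rw [rank, if_neg hy]
    refine Finset.card_lt_card ⟨fun z hz => ?_, fun hsub => ?_⟩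
    · rw [Finset.mem_filter] at hz ⊢
      exact ⟨hz.1, hz.2.trans h⟩
    · have := hsub (Finset.mem_filter.2 ⟨hx, h⟩)
      exact lt_irrefl x (Finset.mem_filter.1 this).2

/-- The points of `S` below `x + 1` are those below `x` together with `x`. -/
theorem rank_add_one {S : Finset ℕ∞} {T : ℕ} {x : ℕ∞} (hx : x ∈ S) (h : x ≠ ⊤) :
    rank S T (x + 1) = rank S T x + 1 := by
  classical
  have h' : x + 1 ≠ ⊤ := by simpa using h
  rw [rank, rank, if_neg h, if_neg h', ← Finset.card_insert_of_notMem (a := x) (by simp)]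
  congr 1
  ext z
  rw [Finset.mem_filter, Finset.mem_insert, Finset.mem_filter, ENat.lt_add_one_iff h,
    le_iff_eq_or_lt]
  constructor
  · tauto
  · rintro (rfl | hz)
    · exact ⟨hx, Or.inl rfl⟩
    · tauto

theorem collapse_rank {S : Finset ℕ∞} {T : ℕ} (hT : S.card ≤ T) (h0 : 0 ∈ S) (ht : ⊤ ∈ S) :
    Collapse (S : Set ℕ∞) T (rank S T) where
  zero_mem := h0
  top_mem := ht
  map_zero := by simp [rank]
  map_top := rank_top S T
  le_iff x hx y hy := by
    constructor
    · intro h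
      by_contra hlt
      exact absurd h (not_le.2 (rank_lt_rank hT hy (not_le.1 hlt)))
    · intro h
      rcases h.eq_or_lt with rfl | h
      · exact le_rfl
      · exact (rank_lt_rank hT hx h).le
  map_add_one x hx _ h := rank_add_one hx h

/-! ### Coding tables by numbers. -/

/-- The size of certificates for the terms with code at most `N`. -/
def size (N : ℕ) : ℕ := 3 * (4 * N + 5) ^ (N + 3)

theorem size_pos (N : ℕ) : 0 < size N := by
  unfold size
  positivity

/-- The entries of a certificate that is given as a number. -/
def entry (T c u p : ℕ) : ℕ := c / (T + 2) ^ (u * (T + 1) + p) % (T + 2)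

theorem exists_digits (b L : ℕ) (d : ℕ → ℕ) (hd : ∀ i, d i < b) :
    ∃ c < b ^ L, ∀ i < L, c / b ^ i % b = d i := by
  induction L with
  | zero => exact ⟨0, by simp, by simp⟩
  | succ L ih =>
    obtain ⟨c, hc, h⟩ := ih
    have hb : 0 < b := (hd 0).pos
    refine ⟨c + b ^ L * d L, ?_, fun i hi => ?_⟩
    · calc c + b ^ L * d L < b ^ L + b ^ L * d L := by omega
        _ = b ^ L * (d L + 1) := by ring
        _ ≤ b ^ L * b := Nat.mul_le_mul_left _ (hd L)
        _ = b ^ (L + 1) := (pow_succ _ _).symm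
    · rcases Nat.lt_succ_iff_lt_or_eq.1 hi with hlt | rfl
      · rw [← h i hlt]
        obtain ⟨j, rfl⟩ := Nat.exists_eq_add_of_lt hlt
        have : b ^ (i + j + 1) * d (i + j + 1) = b ^ i * (b * (b ^ j * d (i + j + 1))) := by ring
        rw [this, Nat.add_mul_div_left _ _ (pow_pos hb _), Nat.add_mul_mod_self_left]
      · rw [Nat.add_mul_div_left _ _ (pow_pos hb _), Nat.div_eq_of_lt hc, zero_add,
          Nat.mod_eq_of_lt (hd i)]

theorem exists_entries (N T : ℕ) (V : ℕ → ℕ → ℕ) (hV : ∀ u p, V u p ≤ T + 1) :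
    ∃ c < (T + 2) ^ ((N + 1) * (T + 1)), ∀ u ≤ N, ∀ p ≤ T, entry T c u p = V u p := by
  obtain ⟨c, hc, h⟩ := exists_digits (T + 2) ((N + 1) * (T + 1))
    (fun i => V (i / (T + 1)) (i % (T + 1))) fun i => Nat.lt_succ_of_le (hV _ _)
  refine ⟨c, hc, fun u hu p hp => ?_⟩
  have hlt : u * (T + 1) + p < (N + 1) * (T + 1) := by
    have := Nat.mul_le_mul_right (T + 1) (Nat.add_le_add_right hu 1)
    rw [Nat.add_mul u 1] at this
    omega
  have h1 : (u * (T + 1) + p) / (T + 1) = u := by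
    rw [mul_comm, Nat.mul_add_div (by omega), Nat.div_eq_of_lt (by omega), add_zero]
  have h2 : (u * (T + 1) + p) % (T + 1) = p := by
    rw [mul_comm, Nat.mul_add_mod, Nat.mod_eq_of_lt (by omega)]
  rw [entry, h _ hlt, h1, h2]

open Classical in
/-- The certificate that is read off from the warps `W 0, …, W N`. -/
noncomputable def table (D : ℕ → Set ℕ∞) (T : ℕ) (π : ℕ∞ → ℕ) (W : ℕ → TimeWarp) (u p : ℕ) :
    ℕ :=
  if h : ∃ x ∈ D u, π x = p then min (π (W u h.choose)) (T + 1) else T + 1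

theorem table_le (D : ℕ → Set ℕ∞) (T : ℕ) (π : ℕ∞ → ℕ) (W : ℕ → TimeWarp) (u p : ℕ) :
    table D T π W u p ≤ T + 1 := by
  unfold table
  split_ifs
  · exact min_le_right _ _
  · exact le_rfl

theorem table_apply {S : Set ℕ∞} {D : ℕ → Set ℕ∞} {T : ℕ} {π : ℕ∞ → ℕ} {W : ℕ → TimeWarp}
    (hπ : Collapse S T π) {u : ℕ} (hD : D u ⊆ S) (hW : ∀ x ∈ D u, W u x ∈ S) {x : ℕ∞}
    (hx : x ∈ D u) : table D T π W u (π x) = π (W u x) := by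
  have h : ∃ y ∈ D u, π y = π x := ⟨x, hx, rfl⟩
  have he : h.choose = x :=
    (hπ.eq_iff (hD h.choose_spec.1) (hD hx)).1 h.choose_spec.2
  rw [table, dif_pos h, he]
  exact min_eq_left ((hπ.le_top (hW x hx)).trans (Nat.le_succ T))

theorem exists_of_table_le {D : ℕ → Set ℕ∞} {T : ℕ} {π : ℕ∞ → ℕ} {W : ℕ → TimeWarp} {u p : ℕ}
    (h : table D T π W u p ≤ T) : ∃ x ∈ D u, π x = p := by
  by_contra hne
  rw [table, dif_neg hne] at h
  omega

/-- Every valuation and every point give rise to a certificate of bounded size. -/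
theorem exists_samples (N : ℕ) (W : ℕ → TimeWarp) (x : ℕ∞) :
    ∃ (S : Set ℕ∞) (π : ℕ∞ → ℕ), Collapse S (size N) π ∧
      ∃ c < (size N + 2) ^ ((N + 1) * (size N + 1)), ∀ u ≤ N,
        Samples S (size N) π (level N W x (N + 2 - u)) (W u) (entry (size N) c u) := by
  set T := size N with hTdef
  -- The row domains reach up to level `N + 2`; one more round puts all their values in `S`. Three
  -- starting points and `N + 3` rounds give the bound `size N`.
  set S := level N W x (N + 3) with hS
  have hSN := mem_level N W x (N + 3)
  have hπ : Collapse (S : Set ℕ∞) T (rank S T) :=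
    collapse_rank (card_level_le N W x (N + 3)) hSN.1 hSN.2.1
  -- Smaller codes get larger domains, so a subterm is sampled at all points that its superterm
  -- demands. Even the row `N` retains two rounds.
  set D : ℕ → Set ℕ∞ := fun u => (level N W x (N + 2 - u) : Finset ℕ∞) with hD
  have hDS : ∀ u, D u ⊆ S := fun u => level_mono N W x (by omega)
  have hWS : ∀ u ≤ N, ∀ y ∈ D u, W u y ∈ (S : Set ℕ∞) := by
    intro u hu y hy
    have h1 : y ∈ level N W x (N + 2) := level_mono N W x (by omega : N + 2 - u ≤ N + 2) hy
    rw [hS, level_succ]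
    exact (mem_demand hu h1).1
  obtain ⟨c, hc, hent⟩ := exists_entries N T (table D T (rank S T) W)
    (table_le D T (rank S T) W)
  refine ⟨S, rank S T, hπ, c, hc, fun u hu => ⟨hDS u, hWS u hu, fun y hy => ?_, fun p hp hv => ?_,
    (mem_level N W x _).2.1, ?_⟩⟩
  · rw [hent u hu _ (hπ.le_top (hDS u hy)), table_apply hπ (hDS u) (hWS u hu) hy]
  · rw [hent u hu p hp] at hv
    exact exists_of_table_le hv
  · rintro ⟨n, hn⟩
    obtain ⟨k, hk, hk'⟩ := TimeWarp.exists_apply_lt_le_apply_add_one (by simp) n hn.symm.le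
    refine ⟨k + 1, ?_, ?_⟩
    · have h := (mem_demand (W := W) hu (mem_level N W x (N + 1 - u)).2.1).2.2.1
      rw [← level_succ, leastGe_eq hk hk'] at h
      rw [show N + 2 - u = N + 1 - u + 1 by omega]
      exact_mod_cast h
    · exact_mod_cast top_le_iff.1 hk'

/-- The assumption `2 ≤ N` provides rows for the three constants. The point `x` is sampled in every
row, so a disagreement there survives the passage to ranks. -/
theorem exists_isCertificate {N : ℕ} (hN : 2 ≤ N) (θ : ℕ → TimeWarp) (x : ℕ∞) :
    ∃ c < (size N + 2) ^ ((N + 1) * (size N + 1)), IsCertificate N (size N) (entry (size N) c) ∧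
      ∀ s t : WarpTerm, s.code ≤ N → t.code ≤ N → s.eval θ x ≠ t.eval θ x →
        ∃ p < size N + 1, entry (size N) c s.code p ≤ size N ∧
          entry (size N) c t.code p ≤ size N ∧
          entry (size N) c s.code p ≠ entry (size N) c t.code p := by
  set W : ℕ → TimeWarp := fun u => (WarpTerm.ofCode u).eval θ with hW
  obtain ⟨S, π, hπ, c, hc, hs⟩ := exists_samples N W x
  have hsub : ∀ {a u : ℕ}, a < u → level N W x (N + 2 - u) ⊆ level N W x (N + 2 - a) :=
    fun h => level_mono N W x (by omega)
  have hdem : ∀ {a u w : ℕ} {y : ℕ∞}, a < u → u ≤ N → w ≤ N → y ∈ level N W x (N + 2 - u) →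
      W w y ∈ level N W x (N + 2 - a) ∧ W w y + 1 ∈ level N W x (N + 2 - a) ∧
      leastGe (W w) y ∈ level N W x (N + 2 - a) ∧
      leastGe (W w) y - 1 ∈ level N W x (N + 2 - a) := by
    intro a u w y ha hu hw hy
    have h := mem_demand (W := W) hw hy
    rw [← level_succ] at h
    have hm := level_mono N W x (by omega : N + 2 - u + 1 ≤ N + 2 - a)
    exact ⟨hm h.1, hm h.2.1, hm h.2.2.1, hm h.2.2.2⟩
  refine ⟨c, hc, ⟨fun u hu => (hs u (by omega)).value_top_le hπ, ?_, ?_, ?_, fun k hk => ?_⟩,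
    fun s t hsN htN hne => ?_⟩
  · have h := hs 0 (by omega)
    simp only [hW, WarpTerm.ofCode, WarpTerm.eval] at h
    exact h.isId
  · have h := hs 1 (by omega)
    simp only [hW, WarpTerm.ofCode, WarpTerm.eval] at h
    exact h.isBot hπ
  · have h := hs 2 (by omega)
    simp only [hW, WarpTerm.ofCode, WarpTerm.eval] at h
    exact h.isTop hπ
  · obtain ⟨e3, e4, e5, e6, e7, e8⟩ := WarpTerm.ofCode_six_mul k
    have hl := k.unpair_left_le
    have hr := k.unpair_right_le
    refine ⟨fun h => ?_, fun h => ?_, fun h => ?_, fun h => ?_, fun h => ?_, fun h => ?_⟩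
    · refine (hs _ h).isVar hπ fun hne => ?_
      obtain ⟨n, hn⟩ := TimeWarp.exists_apply_eq hne
      by_cases h0 : W (6 * k + 3) ⊤ = 0
      · refine ⟨0, (mem_level N W x _).1, ?_⟩
        rw [h0]
        exact TimeWarp.map_zero _
      obtain ⟨m, hm, hm'⟩ := TimeWarp.exists_apply_lt_le_apply_add_one h0 n hn.symm.le
      refine ⟨m + 1, ?_, le_antisymm (TimeWarp.mono _ le_top) (by exact_mod_cast hm')⟩
      -- A variable row uses both spare rounds: one for the value at `ω`, one for the least point
      -- attaining it.
      have h1 := (mem_demand (W := W) h (mem_level N W x (N - (6 * k + 3))).2.1).1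
      rw [← level_succ] at h1
      have h2 := (mem_demand (W := W) h h1).2.2.1
      rw [← level_succ, leastGe_eq hm hm'] at h2
      rw [show N + 2 - (6 * k + 3) = N - (6 * k + 3) + 1 + 1 by omega]
      exact_mod_cast h2
    · have h' := hs _ h
      simp only [hW, e4, WarpTerm.eval] at h'
      exact h'.isMeet hπ (hs k.unpair.1 (by omega)) (hs k.unpair.2 (by omega))
        (hsub (by omega)) (hsub (by omega))
    · have h' := hs _ h
      simp only [hW, e5, WarpTerm.eval] at h'
      exact h'.isJoin hπ (hs k.unpair.1 (by omega)) (hs k.unpair.2 (by omega))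
        (hsub (by omega)) (hsub (by omega))
    · have h' := hs _ h
      simp only [hW, e6, WarpTerm.eval] at h'
      exact h'.isComp hπ (hs k.unpair.1 (by omega)) (hs k.unpair.2 (by omega))
        (hsub (by omega)) fun y hy => (hdem (by omega) h (by omega) hy).1
    · have h' := hs _ h
      have he : W (6 * k + 7) = TimeWarp.ld (W k.unpair.1) (W k.unpair.2) := by
        simp only [hW, e7, WarpTerm.eval]
      rw [he] at h'
      refine h'.isLd hπ (hs k.unpair.1 (by omega)) (hs k.unpair.2 (by omega))
        (hsub (by omega)) fun y hy => ?_
      have := hdem (a := k.unpair.1) (by omega) h h hy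
      rw [he] at this
      exact ⟨this.1, this.2.1⟩
    · have h' := hs _ h
      have he : W (6 * k + 8) = TimeWarp.rd (W k.unpair.1) (W k.unpair.2) := by
        simp only [hW, e8, WarpTerm.eval]
      rw [he] at h'
      refine h'.isRd hπ (hs k.unpair.1 (by omega)) (hs k.unpair.2 (by omega)) ?_
      intro y hy m hm hm'
      -- The jump point is computed from the denominator, but it is needed in the rows of both
      -- arguments.
      have hl' := hdem (a := k.unpair.1) (w := k.unpair.2) (by omega) h (by omega) hy
      have hr' := hdem (a := k.unpair.2) (w := k.unpair.2) (by omega) h (by omega) hy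
      rw [leastGe_eq hm hm'] at hl' hr'
      refine ⟨?_, hr'.2.2.1, hl'.2.2.1⟩
      have := hr'.2.2.2
      rwa [show ((m : ℕ∞) + 1 - 1) = m by norm_cast] at this
  · have h1 := hs _ hsN
    have h2 := hs _ htN
    simp only [hW, WarpTerm.ofCode_code] at h1 h2
    have m1 := (mem_level N W x (N + 2 - s.code)).2.2
    have m2 := (mem_level N W x (N + 2 - t.code)).2.2
    refine ⟨π x, Nat.lt_succ_of_le (hπ.le_top (h1.subset m1)), h1.value_le hπ m1,
      h2.value_le hπ m2, ?_⟩
    rw [h1.value _ m1, h2.value _ m2, Ne, hπ.eq_iff (h1.apply_mem _ m1) (h2.apply_mem _ m2)]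
    exact hne

/-- Invalid equations are the ones that have a refuting certificate. -/
theorem not_models_iff (s t : WarpTerm) {N : ℕ} (hN : 2 ≤ N) (hs : s.code ≤ N)
    (ht : t.code ≤ N) :
    ¬ TimeWarp.Models (s, t) ↔
      ∃ c < (size N + 2) ^ ((N + 1) * (size N + 1)),
        IsCertificate N (size N) (entry (size N) c) ∧
        ∃ p < size N + 1, entry (size N) c s.code p ≤ size N ∧
          entry (size N) c t.code p ≤ size N ∧
          entry (size N) c s.code p ≠ entry (size N) c t.code p := by
  constructor
  · intro h
    simp only [TimeWarp.Models, not_forall] at h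
    obtain ⟨θ, hθ⟩ := h
    obtain ⟨x, hx⟩ : ∃ x, s.eval θ x ≠ t.eval θ x := by
      by_contra! hcon
      exact hθ (sSupHom.ext hcon)
    obtain ⟨c, hc, hcert, hp⟩ := exists_isCertificate hN θ x
    exact ⟨c, hc, hcert, hp s t hs ht hx⟩
  · rintro ⟨c, -, hcert, p, hp, h1, h2, hne⟩ hm
    obtain ⟨θ, hθ⟩ := hcert.exists_represents (size_pos N)
    have e1 := (hθ s hs).value p (by omega) h1
    have e2 := (hθ t ht).value p (by omega) h2
    have e : s.eval θ = t.eval θ := hm θ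
    rw [e, e2] at e1
    exact hne (point_injective h1 h2 e1.symm)

end Row

/-! ### Primitive recursiveness of the certificate conditions and of validity. -/

namespace PrimrecPred

variable {α : Type*} [Primcodable α]

theorem imp {p q : α → Prop} (hp : PrimrecPred p) (hq : PrimrecPred q) :
    PrimrecPred fun a => p a → q a :=
  (hp.not.or hq).of_eq fun _ => imp_iff_not_or.symm

theorem bex_lt {b : α → ℕ} {R : α → ℕ → Prop} (hb : Primrec b)
    (hR : PrimrecPred fun x : α × ℕ => R x.1 x.2) : PrimrecPred fun a => ∃ m < b a, R a m :=
  ((PrimrecRel.exists_mem_list (R := fun m a => R a m) (PrimrecRel.swap hR)).comp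
    (Primrec.list_range.comp hb) Primrec.id).of_eq fun a => by simp

theorem ball_lt {b : α → ℕ} {R : α → ℕ → Prop} (hb : Primrec b)
    (hR : PrimrecPred fun x : α × ℕ => R x.1 x.2) : PrimrecPred fun a => ∀ m < b a, R a m :=
  ((PrimrecRel.forall_mem_list (R := fun m a => R a m) (PrimrecRel.swap hR)).comp
    (Primrec.list_range.comp hb) Primrec.id).of_eq fun a => by simp

end PrimrecPred

namespace Primrec

variable {α : Type*} [Primcodable α] {f g : α → ℕ}

theorem add_nat (hf : Primrec f) (k : ℕ) : Primrec fun a => f a + k :=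
  nat_add.comp hf (const k)

theorem pow_nat (hf : Primrec f) (hg : Primrec g) : Primrec fun a => f a ^ g a :=
  (Primrec₂.unpaired'.1 Nat.Primrec.pow).comp hf hg

end Primrec

namespace Row

open Primrec

variable {α : Type*} [Primcodable α] {T c u a b p v w N : α → ℕ}

theorem primrec_entry (hT : Primrec T) (hc : Primrec c) (hu : Primrec u) (hp : Primrec p) :
    Primrec fun x => entry (T x) (c x) (u x) (p x) :=
  nat_mod.comp
    (nat_div.comp hc ((hT.add_nat 2).pow_nat (nat_add.comp (nat_mul.comp hu (hT.add_nat 1)) hp)))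
    (hT.add_nat 2)

theorem primrec_size (hN : Primrec N) : Primrec fun x => size (N x) :=
  nat_mul.comp (const 3)
    (((nat_mul.comp (const 4) hN).add_nat 5).pow_nat (hN.add_nat 3))

theorem primrecPred_reaches (hT : Primrec T) (hc : Primrec c) (hu : Primrec u) :
    PrimrecPred fun x => Reaches (T x) (entry (T x) (c x) (u x)) := by
  refine .bex_lt hT ?_
  exact Primrec.eq.comp (primrec_entry (hT.comp fst) (hc.comp fst) (hu.comp fst) snd)
    (hT.comp fst)

theorem primrecPred_isId (hT : Primrec T) (hc : Primrec c) (hu : Primrec u) :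
    PrimrecPred fun x => IsId (T x) (entry (T x) (c x) (u x)) := by
  refine .ball_lt (hT.add_nat 1) ?_
  have hT' := hT.comp (fst (α := α) (β := ℕ))
  have hU := primrec_entry hT' (hc.comp fst) (hu.comp fst) snd
  exact (nat_le.comp hU hT').imp (Primrec.eq.comp hU snd)

theorem primrecPred_isBot (hT : Primrec T) (hc : Primrec c) (hu : Primrec u) :
    PrimrecPred fun x => IsBot (T x) (entry (T x) (c x) (u x)) := by
  refine .ball_lt (hT.add_nat 1) ?_
  have hT' := hT.comp (fst (α := α) (β := ℕ))
  have hU := primrec_entry hT' (hc.comp fst) (hu.comp fst) snd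
  exact (nat_le.comp hU hT').imp (Primrec.eq.comp hU (const 0))

theorem primrecPred_isTop (hT : Primrec T) (hc : Primrec c) (hu : Primrec u) :
    PrimrecPred fun x => IsTop (T x) (entry (T x) (c x) (u x)) := by
  refine .and (.ball_lt (hT.add_nat 1) ?_) (primrecPred_reaches hT hc hu)
  have hT' := hT.comp (fst (α := α) (β := ℕ))
  have hU := primrec_entry hT' (hc.comp fst) (hu.comp fst) snd
  have h0 : PrimrecPred fun x : α × ℕ => x.2 = 0 := Primrec.eq.comp snd (const 0)
  exact (nat_le.comp hU hT').imp ((h0.and (Primrec.eq.comp hU (const 0))).or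
    (h0.not.and (Primrec.eq.comp hU hT')))

theorem primrecPred_isVar (hT : Primrec T) (hc : Primrec c) (hu : Primrec u) :
    PrimrecPred fun x => IsVar (T x) (entry (T x) (c x) (u x)) := by
  have hT' := hT.comp (fst (α := α) (β := ℕ))
  have hU := primrec_entry hT' (hc.comp fst) (hu.comp fst) snd
  have hUT := primrec_entry hT hc hu hT
  refine .and (.ball_lt (hT.add_nat 1) ?_) (.or (Primrec.eq.comp hUT hT) (.bex_lt hT ?_))
  · refine (nat_le.comp hU hT').imp (.and ?_ (.ball_lt (hT'.add_nat 1) ?_))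
    · exact (Primrec.eq.comp snd (const 0)).imp (Primrec.eq.comp hU (const 0))
    · have hT'' := hT'.comp (fst (α := α × ℕ) (β := ℕ))
      have hU' := hU.comp (fst (α := α × ℕ) (β := ℕ))
      have hV := primrec_entry hT'' ((hc.comp fst).comp fst) ((hu.comp fst).comp fst) snd
      exact (nat_le.comp (snd.comp fst) snd).imp
        ((nat_le.comp hV hT'').imp (nat_le.comp hU' hV))
  · exact Primrec.eq.comp hU (hUT.comp fst)

theorem primrecPred_isMeet (hT : Primrec T) (hc : Primrec c) (hu : Primrec u) (ha : Primrec a)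
    (hb : Primrec b) :
    PrimrecPred fun x => IsMeet (T x) (entry (T x) (c x) (u x)) (entry (T x) (c x) (a x))
      (entry (T x) (c x) (b x)) := by
  refine .and (.ball_lt (hT.add_nat 1) ?_) ((primrecPred_reaches hT hc ha).imp
    ((primrecPred_reaches hT hc hb).imp (primrecPred_reaches hT hc hu)))
  have hT' := hT.comp (fst (α := α) (β := ℕ))
  have hU := primrec_entry hT' (hc.comp fst) (hu.comp fst) snd
  have hA := primrec_entry hT' (hc.comp fst) (ha.comp fst) snd
  have hB := primrec_entry hT' (hc.comp fst) (hb.comp fst) snd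
  exact (nat_le.comp hU hT').imp ((nat_le.comp hA hT').and
    ((nat_le.comp hB hT').and (Primrec.eq.comp hU (nat_min.comp hA hB))))

theorem primrecPred_isJoin (hT : Primrec T) (hc : Primrec c) (hu : Primrec u) (ha : Primrec a)
    (hb : Primrec b) :
    PrimrecPred fun x => IsJoin (T x) (entry (T x) (c x) (u x)) (entry (T x) (c x) (a x))
      (entry (T x) (c x) (b x)) := by
  refine .and (.ball_lt (hT.add_nat 1) ?_) (((primrecPred_reaches hT hc ha).or
    (primrecPred_reaches hT hc hb)).imp (primrecPred_reaches hT hc hu))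
  have hT' := hT.comp (fst (α := α) (β := ℕ))
  have hU := primrec_entry hT' (hc.comp fst) (hu.comp fst) snd
  have hA := primrec_entry hT' (hc.comp fst) (ha.comp fst) snd
  have hB := primrec_entry hT' (hc.comp fst) (hb.comp fst) snd
  exact (nat_le.comp hU hT').imp ((nat_le.comp hA hT').and
    ((nat_le.comp hB hT').and (Primrec.eq.comp hU (nat_max.comp hA hB))))

theorem primrecPred_isComp (hT : Primrec T) (hc : Primrec c) (hu : Primrec u) (ha : Primrec a)
    (hb : Primrec b) :
    PrimrecPred fun x => IsComp (T x) (entry (T x) (c x) (u x)) (entry (T x) (c x) (a x))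
      (entry (T x) (c x) (b x)) := by
  refine .and (.ball_lt (hT.add_nat 1) ?_)
    ((Primrec.eq.comp (primrec_entry hT hc hu hT) hT).imp
      (((primrecPred_reaches hT hc ha).or (primrecPred_reaches hT hc hb)).imp
        (primrecPred_reaches hT hc hu)))
  have hT' := hT.comp (fst (α := α) (β := ℕ))
  have hU := primrec_entry hT' (hc.comp fst) (hu.comp fst) snd
  have hB := primrec_entry hT' (hc.comp fst) (hb.comp fst) snd
  have hA := primrec_entry hT' (hc.comp fst) (ha.comp fst) hB
  exact (nat_le.comp hU hT').imp ((nat_le.comp hB hT').and (Primrec.eq.comp hU hA))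

theorem primrecPred_isRes (hT : Primrec T) (hc : Primrec c) (ha : Primrec a) (hw : Primrec w)
    (hv : Primrec v) :
    PrimrecPred fun x => IsRes (T x) (entry (T x) (c x) (a x)) (w x) (v x) := by
  have hA := primrec_entry hT hc ha hv
  have hA' := primrec_entry hT hc ha (hv.add_nat 1)
  exact (nat_le.comp hw hT).and ((nat_le.comp hA hw).and ((nat_lt.comp hv hT).imp
    ((nat_lt.comp (hv.add_nat 1) hT).and ((nat_lt.comp hw hA').and (nat_le.comp hA' hT)))))

theorem primrecPred_isLimRes (hT : Primrec T) (hc : Primrec c) (ha : Primrec a)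
    (hv : Primrec v) :
    PrimrecPred fun x => IsLimRes (T x) (entry (T x) (c x) (a x)) (v x) := by
  have hA := primrec_entry hT hc ha hv
  have hA' := primrec_entry hT hc ha (hv.add_nat 1)
  have hR := primrecPred_reaches hT hc ha
  exact (hR.not.imp (Primrec.eq.comp hv hT)).and (hR.imp
    ((nat_lt.comp (hv.add_nat 1) hT).and ((nat_lt.comp hA hT).and (Primrec.eq.comp hA' hT))))

theorem primrecPred_isLd (hT : Primrec T) (hc : Primrec c) (hu : Primrec u) (ha : Primrec a)
    (hb : Primrec b) :
    PrimrecPred fun x => IsLd (T x) (entry (T x) (c x) (u x)) (entry (T x) (c x) (a x))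
      (entry (T x) (c x) (b x)) := by
  have hAT := primrec_entry hT hc ha hT
  have hBT := primrec_entry hT hc hb hT
  refine .and (.ball_lt (hT.add_nat 1) ?_) ((nat_le.comp hAT hBT).imp
    (((nat_lt.comp hAT hT).or (primrecPred_reaches hT hc hb)).imp
      (primrecPred_reaches hT hc hu)))
  have hT' := hT.comp (fst (α := α) (β := ℕ))
  have hc' := hc.comp (fst (α := α) (β := ℕ))
  have ha' := ha.comp (fst (α := α) (β := ℕ))
  have hU := primrec_entry hT' hc' (hu.comp fst) snd
  have hB := primrec_entry hT' hc' (hb.comp fst) snd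
  have hUT := primrec_entry hT' hc' (hu.comp fst) hT'
  have hRB := primrecPred_reaches hT' hc' (hb.comp fst)
  have h0 : PrimrecPred fun x : α × ℕ => x.2 = 0 := Primrec.eq.comp snd (const 0)
  have hpT : PrimrecPred fun x : α × ℕ => x.2 = T x.1 := Primrec.eq.comp snd hT'
  have hB' := Primrec.eq.comp (hBT.comp (fst (α := α) (β := ℕ))) hT'
  exact (nat_le.comp hU hT').imp ((h0.imp (Primrec.eq.comp hU (const 0))).and
    ((hpT.imp (hB'.imp (hRB.not.imp (primrecPred_isLimRes hT' hc' ha' hUT)))).and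
      (h0.not.imp ((hpT.and (hB'.and hRB.not)).not.imp
        (primrecPred_isRes hT' hc' ha' hB hU)))))

theorem primrecPred_isPull (hT : Primrec T) (hc : Primrec c) (ha : Primrec a) (hb : Primrec b)
    (hp : Primrec p) (hv : Primrec v) :
    PrimrecPred fun x => IsPull (T x) (entry (T x) (c x) (a x)) (entry (T x) (c x) (b x)) (p x)
      (v x) := by
  refine .bex_lt hT ?_
  have hT' := hT.comp (fst (α := α) (β := ℕ))
  have hc' := hc.comp (fst (α := α) (β := ℕ))
  have hp' := hp.comp (fst (α := α) (β := ℕ))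
  have hk : Primrec fun x : α × ℕ => x.2 + 1 := snd.add_nat 1
  have hB := primrec_entry hT' hc' (hb.comp fst) snd
  have hB' := primrec_entry hT' hc' (hb.comp fst) hk
  have hA := primrec_entry hT' hc' (ha.comp fst) hk
  exact (nat_lt.comp hk hT').and ((nat_lt.comp hB hp').and ((nat_le.comp hp' hB').and
    ((nat_le.comp hB' hT').and (Primrec.eq.comp (hv.comp fst) hA))))

theorem primrecPred_isRd (hT : Primrec T) (hc : Primrec c) (hu : Primrec u) (ha : Primrec a)
    (hb : Primrec b) :
    PrimrecPred fun x => IsRd (T x) (entry (T x) (c x) (u x)) (entry (T x) (c x) (a x))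
      (entry (T x) (c x) (b x)) := by
  have hUT := primrec_entry hT hc hu hT
  have hAT := primrec_entry hT hc ha hT
  have hBT := primrec_entry hT hc hb hT
  have hRB := primrecPred_reaches hT hc hb
  refine .and (.ball_lt (hT.add_nat 1) ?_) ((Primrec.eq.comp hUT hT).imp
    (((nat_lt.comp hBT hT).or (hRB.or (primrecPred_reaches hT hc ha))).imp
      (primrecPred_reaches hT hc hu)))
  have hT' := hT.comp (fst (α := α) (β := ℕ))
  have hc' := hc.comp (fst (α := α) (β := ℕ))
  have hU := primrec_entry hT' hc' (hu.comp fst) snd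
  have hBT' := hBT.comp (fst (α := α) (β := ℕ))
  have h0 : PrimrecPred fun x : α × ℕ => x.2 = 0 := Primrec.eq.comp snd (const 0)
  have hlim : PrimrecPred fun x : α × ℕ => x.2 = T x.1 ∧
      ¬ Reaches (T x.1) (entry (T x.1) (c x.1) (b x.1)) ∧
      entry (T x.1) (c x.1) (u x.1) (T x.1) = entry (T x.1) (c x.1) (a x.1) (T x.1) :=
    .and (Primrec.eq.comp snd hT')
      (.and (PrimrecPred.comp hRB fst).not (Primrec.eq.comp (hUT.comp fst) (hAT.comp fst)))
  exact (nat_le.comp hU hT').imp ((h0.imp (Primrec.eq.comp hU (const 0))).and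
    (((nat_lt.comp hBT' snd).imp (Primrec.eq.comp hU hT')).and
      (h0.not.imp ((nat_le.comp snd hBT').imp (hlim.or
        (primrecPred_isPull hT' hc' (ha.comp fst) (hb.comp fst) snd hU))))))

theorem primrecPred_isCertificate (hN : Primrec N) (hT : Primrec T) (hc : Primrec c) :
    PrimrecPred fun x => IsCertificate (N x) (T x) (entry (T x) (c x)) := by
  have hT' := hT.comp (fst (α := α) (β := ℕ))
  have hc' := hc.comp (fst (α := α) (β := ℕ))
  have hN' := hN.comp (fst (α := α) (β := ℕ))
  refine .and (.ball_lt (hN.add_nat 1) (nat_le.comp (primrec_entry hT' hc' snd hT') hT'))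
    (.and (primrecPred_isId hT hc (const 0)) (.and (primrecPred_isBot hT hc (const 1))
      (.and (primrecPred_isTop hT hc (const 2)) (.ball_lt (hN.add_nat 1) ?_))))
  have hk (i : ℕ) : Primrec fun x : α × ℕ => 6 * x.2 + i :=
    (nat_mul.comp (const 6) snd).add_nat i
  have ha : Primrec fun x : α × ℕ => x.2.unpair.1 := fst.comp (unpair.comp snd)
  have hb : Primrec fun x : α × ℕ => x.2.unpair.2 := snd.comp (unpair.comp snd)
  exact ((nat_le.comp (hk 3) hN').imp (primrecPred_isVar hT' hc' (hk 3))).and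
    (((nat_le.comp (hk 4) hN').imp (primrecPred_isMeet hT' hc' (hk 4) ha hb)).and
    (((nat_le.comp (hk 5) hN').imp (primrecPred_isJoin hT' hc' (hk 5) ha hb)).and
    (((nat_le.comp (hk 6) hN').imp (primrecPred_isComp hT' hc' (hk 6) ha hb)).and
    (((nat_le.comp (hk 7) hN').imp (primrecPred_isLd hT' hc' (hk 7) ha hb)).and
    ((nat_le.comp (hk 8) hN').imp (primrecPred_isRd hT' hc' (hk 8) ha hb))))))

theorem primrecPred_models : PrimrecPred TimeWarp.Models := by
  -- The Gödel numbering is by definition the encoding of terms.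
  have hs : Primrec fun e : WarpTerm × WarpTerm => e.1.code := Primrec.encode.comp fst
  have ht : Primrec fun e : WarpTerm × WarpTerm => e.2.code := Primrec.encode.comp snd
  -- This choice of `N` bounds the codes of both terms and of the three constants.
  have hN : Primrec fun e : WarpTerm × WarpTerm => e.1.code + e.2.code + 2 :=
    (nat_add.comp hs ht).add_nat 2
  have hT := primrec_size hN
  have hbound := (hT.add_nat 2).pow_nat (nat_mul.comp (hN.add_nat 1) (hT.add_nat 1))
  refine PrimrecPred.of_eq (PrimrecPred.not (PrimrecPred.bex_lt hbound (.and
    (primrecPred_isCertificate (hN.comp fst) (hT.comp fst) snd)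
    (.bex_lt ((hT.comp fst).add_nat 1) ?_)))) fun e => not_iff_comm.1
      (not_models_iff e.1 e.2 (by omega) (by omega) (by omega))
  have hT' := (hT.comp (fst (β := ℕ))).comp (fst (β := ℕ))
  have hS := primrec_entry hT' (snd.comp fst) ((hs.comp fst).comp fst) snd
  have hS' := primrec_entry hT' (snd.comp fst) ((ht.comp fst).comp fst) snd
  exact (nat_le.comp hS hT').and ((nat_le.comp hS' hT').and (Primrec.eq.comp hS hS').not)

end Row

theorem theorem1 :
    ComputablePred fun e : WarpTerm × WarpTerm => e ∈ TimeWarp.equationalTheory := by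
  obtain ⟨hd, h⟩ := Row.primrecPred_models
  exact ⟨hd, h.to_comp⟩
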